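/- Let $\Omega\subset\mathbb R^2$ be a bounded Lipschitz domain with polygonal boundary and let $\mathcal T$ be a regular triangulation of $\Omega$ into triangles: finitely many nondegenerate closed triangles with union $\overline\Omega$, any two distinct ones of which are disjoint or share exactly a common vertex or a common edge. A node is a vertex of a triangle of $\mathcal T$; it is interior if it lies in $\Omega$, and otherwise lies on $\partial\Omega$. For a node $z$ let $\mathcal T(z)$ be the set of the triangles in $\mathcal T$ with vertex $z$ and $\omega_z=\bigcup\mathcal T(z)$; for $T\in\mathcal T$ let $h_T=\operatorname{diam}T$ and let $\omega_T$ be the union of $\omega_z$ over the three vertices $z$ of $T$. Let $h_{\mathcal T}$ be the function equal to $h_T$ on each $T\in\mathcal T$. Let $\omega_0>0$ be a lower bound for all interior angles of all triangles in $\mathcal T$, let $M_{\rm patch}$ be the maximum of $|\mathcal T(z)|$ over all (interior and boundary) nodes $z$, and let $c_{\rm apx}\ge 0$ be given by $$c_{\rm apx}^2=\frac{(\sqrt3/2)\cot\omega_0}{1-\cos(\pi/M_{\rm patch})}.$$ Let $P_1(\mathcal T)$ be the space of functions that are affine on each $T\in\mathcal T$ (possibly discontinuous), let $CR^1_0(\mathcal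 T)$ be the set of $v\in P_1(\mathcal T)$ that are continuous at the midpoints of all interior edges and vanish at the midpoints of all boundary edges, and let $S^1_0(\mathcal T)=P_1(\mathcal T)\cap H^1_0(\Omega)$. For $v\in P_1(\mathcal T)$ let $\nabla_{NC}v$ denote the piecewise gradient. **Theorem.** Let $J_C:CR^1_0(\mathcal T)\to S^1_0(\mathcal T)$ be any (not necessarily linear) map such that, for all $v\in CR^1_0(\mathcal T)$ and every interior node $z$, $$(J_Cv)(z)\in\operatorname{conv}\{\,v|_T(z)\;:\;T\in\mathcal T(z)\,\}.$$ Then every $v_{CR}\in CR^1_0(\mathcal T)$ satisfies $$\|h_{\mathcal T}^{-1}(v_{CR}-J_Cv_{CR})\|_{L^2(\Omega)}\le c_{\rm apx}\,\|\nabla_{NC}v_{CR}\|_{L^2(\Omega)},$$ and, for every $T\in\mathcal T$, $$\|h_T^{-1}(v_{CR}-J_Cv_{CR})\|_{L^2(T)}\le c_{\rm apx}\,\|\nabla_{NC}v_{CR}\|_{L^2(\omega_T)}.$$ -/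

import Mathlib

open MeasureTheory Filter Topology
open scoped ENNReal NNReal ContDiff

noncomputable section

/-- The Euclidean plane. -/
abbrev Plane : Type := EuclideanSpace ℝ (Fin 2)

/-- Bounded Lipschitz domain: a bounded, connected (in particular non-empty) open set which,
near each of its boundary points and after a rigid motion `e`, is the strict epigraph of a
Lipschitz function `g`. -/
structure IsLipschitzDomain (Ω : Set Plane) : Prop where
  isOpen : IsOpen Ω
  isConnected : IsConnected Ω
  isBounded : Bornology.IsBounded Ω
  boundary : ∀ x ∈ frontier Ω, ∃ (e : Plane ≃ᵃⁱ[ℝ] Plane) (K : ℝ≥0) (g : ℝ → ℝ),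
    LipschitzWith K g ∧ ∀ᶠ y in 𝓝 x, (y ∈ Ω ↔ g (e y 0) < e y 1)

/-- `u ∈ H¹₀(Ω)`: the function `u` is an `H¹(Ω)`-limit of smooth functions with compact support
in `Ω`. The `L²`-limit `g` of the gradients of these functions is then the weak gradient of `u`. -/
def MemH10 (Ω : Set Plane) (u : Plane → ℝ) : Prop :=
  MemLp u 2 (volume.restrict Ω) ∧
  ∃ g : Plane → Plane, MemLp g 2 (volume.restrict Ω) ∧
  ∃ φ : ℕ → Plane → ℝ,
    (∀ n, ContDiff ℝ ∞ (φ n) ∧ HasCompactSupport (φ n) ∧ tsupport (φ n) ⊆ Ω) ∧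
    Tendsto (fun n => eLpNorm (fun x => φ n x - u x) 2 (volume.restrict Ω)) atTop (𝓝 0) ∧
    Tendsto (fun n => eLpNorm (fun x => gradient (φ n) x - g x) 2 (volume.restrict Ω))
      atTop (𝓝 0)

/-- A regular (conforming) triangulation of `Ω`: finitely many nondegenerate closed triangles, each
given by its set of vertices, which cover the closure of `Ω`, such that any two of them
intersect exactly in the convex hull of their common vertices (nothing, a vertex, an edge, or
the whole triangle). -/
structure RegularTriangulation (Ω : Set Plane) where
  /-- The triangles, each given by the set of its three vertices. -/
  triangles : Finset (Finset Plane)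
  card_eq_three : ∀ T ∈ triangles, T.card = 3
  affineIndependent : ∀ T ∈ triangles, AffineIndependent ℝ ((↑) : T → Plane)
  inter_eq : ∀ S ∈ triangles, ∀ T ∈ triangles,
    convexHull ℝ (S : Set Plane) ∩ convexHull ℝ (T : Set Plane) =
      convexHull ℝ ((S : Set Plane) ∩ (T : Set Plane))
  cover : ⋃ T ∈ triangles, convexHull ℝ (T : Set Plane) = closure Ω

namespace RegularTriangulation

variable {Ω : Set Plane} (𝒯 : RegularTriangulation Ω)

/-- The sides (edges), each given by the set of its two endpoints. -/
def sides : Set (Finset Plane) := {E | E.card = 2 ∧ ∃ T ∈ 𝒯.triangles, E ⊆ T}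

/-- The sides contained in the boundary of `Ω`. -/
def boundarySides : Set (Finset Plane) :=
  {E | E ∈ 𝒯.sides ∧ convexHull ℝ (E : Set Plane) ⊆ frontier Ω}

/-- The interior sides: those which are not boundary sides. -/
def interiorSides : Set (Finset Plane) := 𝒯.sides \ 𝒯.boundarySides

open Classical in
/-- The nodes of the triangulation. -/
def nodes : Finset Plane := 𝒯.triangles.biUnion id

open Classical in
/-- The interior nodes. -/
def interiorNodes : Finset Plane := 𝒯.nodes.filter (· ∈ Ω)

open Classical in
/-- The boundary nodes. -/
def boundaryNodes : Finset Plane := 𝒯.nodes.filter (· ∈ frontier Ω)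

open Classical in
/-- `𝒯(z)`: the triangles with vertex `z`. -/
def trianglesAt (z : Plane) : Finset (Finset Plane) := 𝒯.triangles.filter (z ∈ ·)

/-- The nodal patch `ω_z`. -/
def nodePatch (z : Plane) : Set Plane := ⋃ T ∈ 𝒯.trianglesAt z, convexHull ℝ (T : Set Plane)

/-- The patch `ω_T` of a triangle, the union of the patches of its vertices. -/
def trianglePatch (T : Finset Plane) : Set Plane := ⋃ z ∈ T, 𝒯.nodePatch z

/-- Maximal number of triangles at an interior node (`0` if there is no interior node). -/
def Mint : ℕ := 𝒯.interiorNodes.sup fun z => (𝒯.trianglesAt z).card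

/-- Maximal number of triangles at a boundary node. -/
def Mbd : ℕ := 𝒯.boundaryNodes.sup fun z => (𝒯.trianglesAt z).card

def Mpatch : ℕ := max 𝒯.Mint 𝒯.Mbd

/-- All interior angles of all triangles are at least `ω₀`. -/
def MinAngleAtLeast (ω₀ : ℝ) : Prop :=
  ∀ T ∈ 𝒯.triangles, ∀ a ∈ T, ∀ b ∈ T, ∀ c ∈ T, a ≠ b → b ≠ c → a ≠ c →
    ω₀ ≤ EuclideanGeometry.angle a b c

/-- `c_apx`, given by `c_apx² = (√3 / 2) cot ω₀ / (1 - cos (π / M_patch))`. -/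
def capx (ω₀ : ℝ) : ℝ :=
  √((√3 / 2) * Real.cot ω₀ / (1 - Real.cos (Real.pi / 𝒯.Mpatch)))

/-- The function on the union of the triangles which equals `f T` in the interior of the triangle
`T`. (On the edges, a null set, it is zero.) -/
def piecewise {F : Type*} [AddCommMonoid F] (f : 𝒯.triangles → Plane → F) : Plane → F :=
  fun x => ∑ T : 𝒯.triangles, (interior (convexHull ℝ (T.1 : Set Plane))).indicator (f T) x

/-- The mesh size function, equal to `h_T = diam T` in each triangle `T`. -/
def meshSize : Plane → ℝ :=
  𝒯.piecewise fun T _ => Metric.diam (convexHull ℝ (T.1 : Set Plane))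

/-- `P₁(𝒯)`, the piecewise affine functions without continuity requirement: one affine function
`v|_T` for each triangle `T`. -/
abbrev P1 : Type := 𝒯.triangles → (Plane →ᵃ[ℝ] ℝ)

variable {𝒯}

/-- The function on the domain (defined almost everywhere) given by an element of `P₁(𝒯)`. -/
def P1.toFun (v : 𝒯.P1) : Plane → ℝ := 𝒯.piecewise fun T => v T

/-- The piecewise gradient `∇_NC v`. -/
def P1.gradNC (v : 𝒯.P1) : Plane → Plane := 𝒯.piecewise fun T => gradient (v T)

variable (𝒯)

/-- The Crouzeix–Raviart space `CR¹₀(𝒯)`: piecewise affine functions, continuous at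
the midpoints of the interior sides and zero at the midpoints of the boundary sides. -/
def CR10 : Set 𝒯.P1 :=
  {v | (∀ a b : Plane, ∀ E ∈ 𝒯.interiorSides, (E : Set Plane) = {a, b} →
          ∀ S T : 𝒯.triangles, E ⊆ S.1 → E ⊆ T.1 → v S (midpoint ℝ a b) = v T (midpoint ℝ a b)) ∧
       (∀ a b : Plane, ∀ E ∈ 𝒯.boundarySides, (E : Set Plane) = {a, b} →
          ∀ T : 𝒯.triangles, E ⊆ T.1 → v T (midpoint ℝ a b) = 0)}

/-- The conforming space `S¹₀(𝒯) = P₁(𝒯) ∩ H¹₀(Ω)`. -/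
def S10 : Set 𝒯.P1 := {w | MemH10 Ω w.toFun}

/-- The condition `J v (z) ∈ conv {v|_T(z) | T ∈ 𝒯(z)}` at all interior nodes `z`.
As `J v` is continuous, its nodal value at `z` is `(J v)|_K (z)` for every triangle `K` at `z`. -/
def ConvexNodalValues (J : 𝒯.CR10 → 𝒯.S10) : Prop :=
  ∀ v : 𝒯.CR10, ∀ z ∈ 𝒯.interiorNodes, ∀ K : 𝒯.triangles, z ∈ K.1 →
    (J v).1 K z ∈ convexHull ℝ {t : ℝ | ∃ T : 𝒯.triangles, z ∈ T.1 ∧ t = v.1 T z}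

end RegularTriangulation

/-- The norm of `L²(S)`, with values in `[0, ∞]`. -/
def L2norm {F : Type*} [NormedAddCommGroup F] (f : Plane → F) (S : Set Plane) : ℝ≥0∞ :=
  eLpNorm f 2 (volume.restrict S)

end

/-!
Write `e = v - J v`, which is affine on each triangle. On a triangle `T`, Jensen's inequality for
the barycentric coordinates gives `‖e‖²_{L²(T)} ≤ |T| / 3 · ∑_{z ∈ T} e|_T(z)²`, and
`|T| ≤ (√3 / 4) h_T²` by Weitzenböck's inequality, so everything reduces to the nodal values of `e`
(`lintegral_diam_inv_mul_sq_le`).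

At a node `z`, let `x_T = v|_T(z)` for the `n` triangles `T` at `z`, and let `y` be the nodal value
of `J v`. Then
`(1 - cos (π / n)) ∑_T (x_T - y)² ≤ ∑_T ∑_{b ∈ T} (v|_T(z) - v|_T(b))² / 4`
(`node_sum_sq_le`). Indeed, since `v` is continuous at midpoints of interior sides, the jump
`x_S - x_T` across a side `{z, b}` equals the difference of the two numbers
`(v|_S(z) - v|_S(b)) / 2` and `(v|_T(z) - v|_T(b)) / 2`; at a boundary side this number is `x_T`
itself. What remains is an eigenvalue bound on a graph, proved with Picone's inequality:
* at an interior node the triangles form a cycle. By convexity it suffices to consider `y = x_k` for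
  one of the triangles, where `x - y` vanishes, and the positive supersolution `sin (j π / n)` shows
  `discrete_friedrichs_cycle`;
* at a boundary node `y = 0` and the triangles form paths which end at boundary sides; the
  supersolution `sin ((j + 1/2) π / n)` shows `discrete_friedrichs_path`.

Summing over the nodes, each triangle contributes half the sum over its sides `E` of
`(∇v · E)² ≤ |∇v|² |E|²`, and `∑_E |E|²` is `4 |T|` times the sum of the cotangents of the angles,
hence at most `12 |T| cot ω₀` (`sum_diff_sq_le`).

Two facts are needed to make this rigorous. First, the structure of the triangles at a node: if each
side at `z` of a triangle in a non-empty set `C` of triangles at `z` belongs to another triangle in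
`C`, then `C` covers a neighbourhood of `z`, because it cuts out an open and closed subset of a
small circle (`biUnion_mem_nhds_of_closed_fan`); so there are no cycles at boundary nodes and just
one at an interior node. Second, a piecewise affine function in `H¹₀(Ω)` is continuous across
interior sides and vanishes on boundary sides, since the `L²` distance of an `H¹` function and its
translate by `h` is `O(|h|)`, and a jump would make it of order `|h|^(1/2)` (`eq_of_translate_le`).
-/

/-! ### Discrete Friedrichs inequalities on paths and cycles -/

/-- Pairing the "left" term of each `T` with the "right" term of its successor (the `T'` with
`l T = r T'`) shows that the sum of all the terms is nonnegative. -/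
theorem sum_add_sum_nonneg_of_pairing {V α : Type*} [Fintype V] {l r : V → α}
    (hl : Function.Injective l) (hr : Function.Injective r) {u w : V → ℝ}
    (hpair : ∀ T T', l T = r T' → 0 ≤ u T + w T')
    (hu : ∀ T, (∀ T', l T ≠ r T') → 0 ≤ u T)
    (hw : ∀ T', (∀ T, l T ≠ r T') → 0 ≤ w T') :
    0 ≤ ∑ T, u T + ∑ T, w T := by
  classical
  have h1 : ∑ T, ∑ T', (if l T = r T' then u T else 0) ≤ ∑ T, u T := by
    refine Finset.sum_le_sum fun T _ => ?_
    by_cases h : ∃ T', l T = r T'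
    · obtain ⟨T', hT'⟩ := h
      rw [Finset.sum_eq_single T' (fun b _ hb => if_neg fun h => hb (hr (h.symm.trans hT')))
        (by simp), if_pos hT']
    · push Not at h
      rw [Finset.sum_eq_zero fun b _ => if_neg (h b)]
      exact hu T h
  have h2 : ∑ T, ∑ T', (if l T = r T' then w T' else 0) ≤ ∑ T, w T := by
    rw [Finset.sum_comm]
    refine Finset.sum_le_sum fun T' _ => ?_
    by_cases h : ∃ T, l T = r T'
    · obtain ⟨T, hT⟩ := h
      rw [Finset.sum_eq_single T (fun b _ hb => if_neg fun h => hb (hl (h.trans hT.symm)))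
        (by simp), if_pos hT]
    · push Not at h
      rw [Finset.sum_eq_zero fun b _ => if_neg (h b)]
      exact hw T' h
  refine le_trans ?_ (add_le_add h1 h2)
  rw [← Finset.sum_add_distrib]
  refine Finset.sum_nonneg fun T _ => ?_
  rw [← Finset.sum_add_distrib]
  refine Finset.sum_nonneg fun T' _ => ?_
  split_ifs with h
  · exact hpair T T' h
  · simp

/-- An acyclic relation with unique predecessors on a finite type has a rank function: the number
of ancestors. -/
theorem exists_rank_of_acyclic {V : Type*} [Fintype V] {R : V → V → Prop}
    (hacyc : ∀ T, ¬ Relation.TransGen R T T) (huniq : ∀ a b c, R a c → R b c → a = b) :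
    ∃ j : V → ℕ, (∀ T, j T + 1 ≤ Fintype.card V) ∧ ∀ a b, R a b → j b = j a + 1 := by
  classical
  refine ⟨fun T => (Finset.univ.filter fun S => Relation.TransGen R S T).card, fun T => ?_,
    fun a b hab => ?_⟩
  · refine Nat.succ_le_of_lt (Finset.card_lt_univ_of_notMem (x := T) ?_)
    simpa using hacyc T
  · have : (Finset.univ.filter fun S => Relation.TransGen R S b) =
        insert a (Finset.univ.filter fun S => Relation.TransGen R S a) := by
      ext S
      simp only [Finset.mem_filter, Finset.mem_univ, true_and, Finset.mem_insert]
      constructor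
      · intro h
        rcases h with h | ⟨h1, h2⟩
        · exact Or.inl (huniq _ _ _ h hab)
        · exact Or.inr (huniq _ _ _ h2 hab ▸ h1)
      · rintro (rfl | h)
        · exact .single hab
        · exact h.tail hab
    beta_reduce
    rw [this, Finset.card_insert_of_notMem (by simpa using hacyc a)]

/-- Picone's inequality for a single edge with positive weights `p`, `q` at its endpoints. -/
theorem picone_edge {x y p q : ℝ} (hp : 0 < p) (hq : 0 < q) :
    x ^ 2 * (1 - q / p) + y ^ 2 * (1 - p / q) ≤ (x - y) ^ 2 := by
  have h : (x - y) ^ 2 - (x ^ 2 * (1 - q / p) + y ^ 2 * (1 - p / q)) =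
      (x * q - y * p) ^ 2 / (p * q) := by
    field_simp
    ring
  have : 0 ≤ (x * q - y * p) ^ 2 / (p * q) := by positivity
  linarith

/-- Discrete Friedrichs inequality for the triangles at a boundary node: the graph in which
`T'` succeeds `T` when `l T = r T'` is a union of paths, and `f` vanishes "beyond" the two ends of
each of them. The positive supersolution used in Picone's inequality is
`sin ((j + 1/2) π / n)`, where `j` is the position in the path. -/
theorem discrete_friedrichs_path {V α : Type*} [Fintype V] {l r : V → α}
    (hl : Function.Injective l) (hr : Function.Injective r) {f dl dr : V → ℝ}
    (hacyc : ∀ T, ¬ Relation.TransGen (fun T T' => l T = r T') T T)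
    (hpair : ∀ T T', l T = r T' → f T - f T' = dl T - dr T')
    (hl0 : ∀ T, (∀ T', l T ≠ r T') → f T = dl T)
    (hr0 : ∀ T', (∀ T, l T ≠ r T') → f T' = dr T') :
    (1 - Real.cos (Real.pi / Fintype.card V)) * ∑ T, f T ^ 2 ≤ ∑ T, (dl T ^ 2 + dr T ^ 2) := by
  obtain ⟨j, hj, hjs⟩ := exists_rank_of_acyclic hacyc
    (fun a b c (hac : l a = r c) hbc => hl (hac.trans hbc.symm))
  set n := Fintype.card V with hn
  set θ : ℝ := Real.pi / n with hθ
  set φ : ℝ → ℝ := fun i => Real.sin ((i + 1 / 2) * θ) with hφ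
  have hpi := Real.pi_pos
  have hn0 : ∀ T, (1 : ℝ) ≤ n := fun T => by
    have := hj T
    exact_mod_cast (by omega : 1 ≤ n)
  have hjn : ∀ T, (j T : ℝ) + 1 ≤ n := fun T => by exact_mod_cast hj T
  have hnθ : ∀ T : V, n * θ = Real.pi := fun T => by
    have := hn0 T
    rw [hθ]; field_simp
  have hθ0 : ∀ T : V, 0 < θ := fun T => by
    have := hn0 T
    rw [hθ]; positivity
  have hφpos : ∀ T, 0 < φ (j T) := fun T => by
    have h1 := hjn T
    have h2 := hnθ T
    have h3 := hθ0 T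
    have h4 : (0 : ℝ) ≤ j T := Nat.cast_nonneg _
    refine Real.sin_pos_of_pos_of_lt_pi (by positivity) ?_
    rw [← h2]
    exact mul_lt_mul_of_pos_right (by linarith) h3
  have hcos : ∀ T : V, 0 ≤ Real.cos (θ / 2) := fun T => by
    have h1 := hn0 T
    have h3 := hθ0 T
    have : θ ≤ Real.pi := by
      rw [← hnθ T]; exact le_mul_of_one_le_left h3.le h1
    exact Real.cos_nonneg_of_mem_Icc ⟨by linarith, by linarith⟩
  -- the weights at the "next" and the "previous" position are at least `-φ (j T)`
  have hnext : ∀ T, -φ (j T) ≤ φ (j T + 1) := fun T => by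
    have h4 : (0 : ℝ) ≤ j T := Nat.cast_nonneg _
    have e : φ (j T + 1) + φ (j T) = 2 * (Real.sin ((j T + 1) * θ) * Real.cos (θ / 2)) := by
      have e1 : ((j T : ℝ) + 1 + 1 / 2) * θ = (j T + 1) * θ + θ / 2 := by ring
      have e2 : ((j T : ℝ) + 1 / 2) * θ = (j T + 1) * θ - θ / 2 := by ring
      simp only [hφ]
      rw [e1, e2, Real.sin_add, Real.sin_sub]; ring
    have : 0 ≤ Real.sin ((j T + 1) * θ) := by
      refine Real.sin_nonneg_of_nonneg_of_le_pi (by have := hθ0 T; positivity) ?_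
      rw [← hnθ T]
      exact mul_le_mul_of_nonneg_right (hjn T) (hθ0 T).le
    have := mul_nonneg this (hcos T)
    linarith
  have hprev : ∀ T, -φ (j T) ≤ φ (j T - 1) := fun T => by
    have h4 : (0 : ℝ) ≤ j T := Nat.cast_nonneg _
    have e : φ (j T - 1) + φ (j T) = 2 * (Real.sin (j T * θ) * Real.cos (θ / 2)) := by
      have e1 : ((j T : ℝ) - 1 + 1 / 2) * θ = j T * θ - θ / 2 := by ring
      have e2 : ((j T : ℝ) + 1 / 2) * θ = j T * θ + θ / 2 := by ring
      simp only [hφ]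
      rw [e1, e2, Real.sin_add, Real.sin_sub]; ring
    have : 0 ≤ Real.sin (j T * θ) := by
      refine Real.sin_nonneg_of_nonneg_of_le_pi (by have := hθ0 T; positivity) ?_
      rw [← hnθ T]
      exact mul_le_mul_of_nonneg_right (by linarith [hjn T]) (hθ0 T).le
    have := mul_nonneg this (hcos T)
    linarith
  have hsum : ∀ T, φ (j T + 1) + φ (j T - 1) = 2 * (Real.cos θ * φ (j T)) := fun T => by
    have e1 : ((j T : ℝ) + 1 + 1 / 2) * θ = (j T + 1 / 2) * θ + θ := by ring
    have e2 : ((j T : ℝ) - 1 + 1 / 2) * θ = (j T + 1 / 2) * θ - θ := by ring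
    simp only [hφ]
    rw [e1, e2, Real.sin_add, Real.sin_sub]; ring
  set a : V → ℝ := fun T => (1 - φ (j T + 1) / φ (j T)) / 2 with ha
  set b : V → ℝ := fun T => (1 - φ (j T - 1) / φ (j T)) / 2 with hb
  have hab : ∀ T, a T + b T = 1 - Real.cos θ := fun T => by
    have := (hφpos T).ne'
    have h2 : φ (j T + 1) / φ (j T) + φ (j T - 1) / φ (j T) = 2 * Real.cos θ := by
      rw [← add_div, hsum]; field_simp
    simp only [ha, hb]
    linarith
  have hale : ∀ T, a T ≤ 1 := fun T => by
    have : -1 ≤ φ (j T + 1) / φ (j T) := by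
      rw [le_div_iff₀ (hφpos T)]; linarith [hnext T]
    simp only [ha]; linarith
  have hble : ∀ T, b T ≤ 1 := fun T => by
    have : -1 ≤ φ (j T - 1) / φ (j T) := by
      rw [le_div_iff₀ (hφpos T)]; linarith [hprev T]
    simp only [hb]; linarith
  have key := sum_add_sum_nonneg_of_pairing hl hr
    (u := fun T => dl T ^ 2 - a T * f T ^ 2) (w := fun T => dr T ^ 2 - b T * f T ^ 2) ?_ ?_ ?_
  · have e : (1 - Real.cos θ) * ∑ T, f T ^ 2 = ∑ T, (a T * f T ^ 2 + b T * f T ^ 2) := by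
      rw [Finset.mul_sum]
      exact Finset.sum_congr rfl fun T _ => by rw [← add_mul, hab]
    rw [e]
    simp only [Finset.sum_add_distrib, Finset.sum_sub_distrib] at key ⊢
    linarith
  · intro T T' h
    have h1 : (j T' : ℝ) = j T + 1 := by exact_mod_cast hjs T T' h
    have h2 := picone_edge (x := f T) (y := f T') (hφpos T) (hφpos T')
    have h3 := hpair T T' h
    simp only [ha, hb]
    rw [h1] at h2 ⊢
    rw [h3] at h2
    rw [add_sub_cancel_right]
    nlinarith [sq_nonneg (dl T + dr T')]
  · intro T h
    have := mul_le_mul_of_nonneg_right (hale T) (sq_nonneg (f T))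
    rw [← hl0 T h]
    linarith
  · intro T h
    have := mul_le_mul_of_nonneg_right (hble T) (sq_nonneg (f T))
    rw [← hr0 T h]
    linarith

/-- Discrete Friedrichs inequality for the triangles at an interior node: in the graph in which
`T'` succeeds `T` when `l T = r T'`, each `T` has a successor and a predecessor, and `f` vanishes
at a vertex `k` through which each cycle passes. The positive supersolution used in Picone's
inequality is `sin (j π / n)`, where `j` is the position after cutting the cycle at `k`. -/
theorem discrete_friedrichs_cycle {V α : Type*} [Fintype V] {l r : V → α}
    (hl : Function.Injective l) (hr : Function.Injective r) {f dl dr : V → ℝ} {k : V}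
    (hsucc : ∀ T, ∃ T', l T = r T') (hpred : ∀ T', ∃ T, l T = r T')
    (hacyc : ∀ T, ¬ Relation.TransGen (fun T T' => l T = r T' ∧ T' ≠ k) T T)
    (hpair : ∀ T T', l T = r T' → f T - f T' = dl T - dr T') (hk : f k = 0) :
    (1 - Real.cos (Real.pi / Fintype.card V)) * ∑ T, f T ^ 2 ≤ ∑ T, (dl T ^ 2 + dr T ^ 2) := by
  obtain ⟨j, hj, hjs⟩ := exists_rank_of_acyclic hacyc
    (fun a b c (hac : l a = r c ∧ _) hbc => hl (hac.1.trans hbc.1.symm))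
  set n := Fintype.card V with hn
  set θ : ℝ := Real.pi / n with hθ
  set φ : ℝ → ℝ := fun i => Real.sin (i * θ) with hφ
  have hpi := Real.pi_pos
  have hn0 : (1 : ℝ) ≤ n := by
    have := hj k
    exact_mod_cast (by omega : 1 ≤ n)
  have hjn : ∀ T, (j T : ℝ) + 1 ≤ n := fun T => by exact_mod_cast hj T
  have hnθ : n * θ = Real.pi := by rw [hθ]; field_simp
  have hθ0 : 0 < θ := by rw [hθ]; positivity
  have hj1 : ∀ T, T ≠ k → (1 : ℝ) ≤ j T := fun T hT => by
    obtain ⟨S, hS⟩ := hpred T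
    have := hjs S T ⟨hS, hT⟩
    exact_mod_cast (by omega : 1 ≤ j T)
  have hφnonneg : ∀ i : ℝ, 0 ≤ i → i ≤ n → 0 ≤ φ i := fun i h0 h1 =>
    Real.sin_nonneg_of_nonneg_of_le_pi (by positivity)
      (hnθ ▸ mul_le_mul_of_nonneg_right h1 hθ0.le)
  have hφpos : ∀ T, T ≠ k → 0 < φ (j T) := fun T hT => by
    have h1 := hjn T
    have h4 := hj1 T hT
    refine Real.sin_pos_of_pos_of_lt_pi (by positivity) ?_
    rw [← hnθ]
    exact mul_lt_mul_of_pos_right (by linarith) hθ0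
  have hsum : ∀ i : ℝ, φ (i + 1) + φ (i - 1) = 2 * (Real.cos θ * φ i) := fun i => by
    have e1 : (i + 1) * θ = i * θ + θ := by ring
    have e2 : (i - 1) * θ = i * θ - θ := by ring
    simp only [hφ]
    rw [e1, e2, Real.sin_add, Real.sin_sub]; ring
  set a : V → ℝ := fun T => (1 - φ (j T + 1) / φ (j T)) / 2 with ha
  set b : V → ℝ := fun T => (1 - φ (j T - 1) / φ (j T)) / 2 with hb
  have hab : ∀ T, T ≠ k → a T + b T = 1 - Real.cos θ := fun T hT => by
    have := (hφpos T hT).ne'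
    have h2 : φ (j T + 1) / φ (j T) + φ (j T - 1) / φ (j T) = 2 * Real.cos θ := by
      rw [← add_div, hsum]; field_simp
    simp only [ha, hb]
    linarith
  have hale : ∀ T, T ≠ k → a T ≤ 1 / 2 := fun T hT => by
    have : 0 ≤ φ (j T + 1) / φ (j T) :=
      div_nonneg (hφnonneg _ (by positivity) (hjn T)) (hφpos T hT).le
    simp only [ha]; linarith
  have hble : ∀ T, T ≠ k → b T ≤ 1 / 2 := fun T hT => by
    have : 0 ≤ φ (j T - 1) / φ (j T) :=
      div_nonneg (hφnonneg _ (by linarith [hj1 T hT]) (by linarith [hjn T])) (hφpos T hT).le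
    simp only [hb]; linarith
  have key := sum_add_sum_nonneg_of_pairing hl hr
    (u := fun T => dl T ^ 2 - a T * f T ^ 2) (w := fun T => dr T ^ 2 - b T * f T ^ 2) ?_ ?_ ?_
  · have e : (1 - Real.cos θ) * ∑ T, f T ^ 2 = ∑ T, (a T * f T ^ 2 + b T * f T ^ 2) := by
      rw [Finset.mul_sum]
      refine Finset.sum_congr rfl fun T _ => ?_
      by_cases hT : T = k
      · subst hT; simp [hk]
      · rw [← add_mul, hab T hT]
    rw [e]
    simp only [Finset.sum_add_distrib, Finset.sum_sub_distrib] at key ⊢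
    linarith
  · intro T T' h
    have h3 := hpair T T' h
    have h4 : (f T - f T') ^ 2 ≤ 2 * (dl T ^ 2 + dr T' ^ 2) := by
      rw [h3]; nlinarith [sq_nonneg (dl T + dr T')]
    by_cases hT : T = k
    · subst hT
      by_cases hT' : T' = T
      · subst hT'; simp only [hk]; nlinarith [sq_nonneg (dl T'), sq_nonneg (dr T')]
      · have := mul_le_mul_of_nonneg_right (hble T' hT') (sq_nonneg (f T'))
        simp only [hk] at h4 ⊢
        linarith
    · by_cases hT' : T' = k
      · subst hT'
        have := mul_le_mul_of_nonneg_right (hale T hT) (sq_nonneg (f T))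
        simp only [hk] at h4 ⊢
        linarith
      · have h1 : (j T' : ℝ) = j T + 1 := by exact_mod_cast hjs T T' ⟨h, hT'⟩
        have h2 := picone_edge (x := f T) (y := f T') (hφpos T hT) (hφpos T' hT')
        simp only [ha, hb]
        rw [h1] at h2 ⊢
        rw [add_sub_cancel_right]
        linarith
  · intro T h
    obtain ⟨T', hT'⟩ := hsucc T
    exact absurd hT' (h T')
  · intro T' h
    obtain ⟨T, hT⟩ := hpred T'
    exact absurd hT (h T)

/-! ### Barycentric coordinates and the local geometry of the triangulation -/

/-- `lam p`, for `p ∈ T`, are the barycentric coordinates of the triangle with vertex set `T`. -/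
structure IsBarycentric (T : Finset Plane) (lam : Plane → Plane →ᵃ[ℝ] ℝ) : Prop where
  self : ∀ p ∈ T, lam p p = 1
  of_ne : ∀ p ∈ T, ∀ q ∈ T, p ≠ q → lam p q = 0
  mem_hull : ∀ x, x ∈ convexHull ℝ (T : Set Plane) ↔ ∀ p ∈ T, 0 ≤ lam p x
  mem_interior : ∀ x, x ∈ interior (convexHull ℝ (T : Set Plane)) ↔ ∀ p ∈ T, 0 < lam p x
  expand : ∀ (f : Plane →ᵃ[ℝ] ℝ) (x : Plane), f x = ∑ p ∈ T, lam p x * f p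

theorem exists_isBarycentric {T : Finset Plane} (hcard : T.card = 3)
    (hT : AffineIndependent ℝ ((↑) : T → Plane)) : ∃ lam, IsBarycentric T lam := by
  classical
  have htop : affineSpan ℝ (Set.range ((↑) : T → Plane)) = ⊤ := by
    rw [hT.affineSpan_eq_top_iff_card_eq_finrank_add_one]
    simp [hcard]
  let b : AffineBasis T ℝ Plane := ⟨(↑), hT, htop⟩
  have hrange : Set.range b = (T : Set Plane) := Subtype.range_coe
  have hb : ∀ i : T, b i = i := fun i => rfl
  refine ⟨fun p => if hp : p ∈ T then b.coord ⟨p, hp⟩ else 0, ?_, ?_, ?_, ?_, ?_⟩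
  · intro p hp
    have := b.coord_apply_eq ⟨p, hp⟩
    simpa [hp, hb] using this
  · intro p hp q hq hpq
    have := b.coord_apply_ne (i := ⟨p, hp⟩) (j := ⟨q, hq⟩) (by simpa using hpq)
    simpa [hp, hb] using this
  · intro x
    rw [← hrange, b.convexHull_eq_nonneg_coord]
    constructor
    · intro h p hp
      simpa [hp] using h ⟨p, hp⟩
    · rintro h ⟨p, hp⟩
      simpa [hp] using h p hp
  · intro x
    rw [← hrange, b.interior_convexHull]
    constructor
    · intro h p hp
      simpa [hp] using h ⟨p, hp⟩
    · rintro h ⟨p, hp⟩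
      simpa [hp] using h p hp
  · intro f x
    have h1 : f x = f (Finset.univ.affineCombination ℝ b fun i => b.coord i x) := by
      rw [b.affineCombination_coord_eq_self]
    rw [h1, Finset.map_affineCombination _ _ _ (b.sum_coord_apply_eq_one x),
      Finset.affineCombination_eq_linear_combination _ _ _ (b.sum_coord_apply_eq_one x),
      ← Finset.sum_coe_sort T]
    refine Finset.sum_congr rfl fun i _ => ?_
    simp [hb]

/-- `a`, `b`, `c` are the three distinct vertices of the triangle `T`. -/
structure HasVertices (T : Finset Plane) (a b c : Plane) : Prop where
  ne₁₂ : a ≠ b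
  ne₁₃ : a ≠ c
  ne₂₃ : b ≠ c
  mem_iff : ∀ p, p ∈ T ↔ p = a ∨ p = b ∨ p = c

namespace HasVertices

variable {T S : Finset Plane} {a b c : Plane}

theorem mem₁ (h : HasVertices T a b c) : a ∈ T := by simp [h.mem_iff]
theorem mem₂ (h : HasVertices T a b c) : b ∈ T := by simp [h.mem_iff]
theorem mem₃ (h : HasVertices T a b c) : c ∈ T := by simp [h.mem_iff]

theorem swap (h : HasVertices T a b c) : HasVertices T b a c :=
  ⟨h.ne₁₂.symm, h.ne₂₃, h.ne₁₃, fun p => by rw [h.mem_iff]; tauto⟩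

theorem rotate (h : HasVertices T a b c) : HasVertices T b c a :=
  ⟨h.ne₂₃, h.ne₁₂.symm, h.ne₁₃.symm, fun p => by rw [h.mem_iff]; tauto⟩

theorem sum_eq {F : Type*} [AddCommMonoid F] (h : HasVertices T a b c) (f : Plane → F) :
    ∑ p ∈ T, f p = f a + f b + f c := by
  classical
  have : T = {a, b, c} := by
    ext p; simp [h.mem_iff]
  rw [this, Finset.sum_insert (by simp [h.ne₁₂, h.ne₁₃]), Finset.sum_insert (by simp [h.ne₂₃]),
    Finset.sum_singleton, add_assoc]

theorem forall_iff (h : HasVertices T a b c) {P : Plane → Prop} :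
    (∀ p ∈ T, P p) ↔ P a ∧ P b ∧ P c := by
  simp [h.mem_iff]

theorem eq_of_eq (h : HasVertices T a b c) (h' : HasVertices S a b c) : S = T := by
  ext p; rw [h.mem_iff, h'.mem_iff]

end HasVertices

theorem exists_hasVertices {T : Finset Plane} (hT : T.card = 3) {a b : Plane} (ha : a ∈ T)
    (hb : b ∈ T) (hab : a ≠ b) : ∃ c, HasVertices T a b c := by
  classical
  have h1 : ((T.erase a).erase b).card = 1 := by
    rw [Finset.card_erase_of_mem (by simp [hb, hab.symm]), Finset.card_erase_of_mem ha, hT]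
  obtain ⟨c, hc⟩ := Finset.card_eq_one.1 h1
  have hc' : ∀ p, (p ≠ b ∧ p ≠ a ∧ p ∈ T) ↔ p = c := fun p => by
    rw [← Finset.mem_singleton, ← hc]; simp
  have := (hc' c).2 rfl
  refine ⟨c, hab, this.2.1.symm, this.1.symm, fun p => ?_⟩
  constructor
  · intro hp
    by_cases h1 : p = a
    · exact Or.inl h1
    by_cases h2 : p = b
    · exact Or.inr (Or.inl h2)
    exact Or.inr (Or.inr ((hc' p).1 ⟨h2, h1, hp⟩))
  · rintro (rfl | rfl | rfl)
    exacts [ha, hb, this.2.2]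

theorem exists_hasVertices_of_mem {T : Finset Plane} (hT : T.card = 3) {a : Plane} (ha : a ∈ T) :
    ∃ b c, HasVertices T a b c := by
  obtain ⟨b, hb, hba⟩ := Finset.exists_mem_ne (by omega : 1 < T.card) a
  exact ⟨b, exists_hasVertices hT ha hb hba.symm⟩

theorem AffineMap.continuous_plane (f : Plane →ᵃ[ℝ] ℝ) : Continuous f :=
  f.continuous_of_finiteDimensional

/-- An affine function vanishing at the vertices `a`, `b` of a triangle is a multiple of the
barycentric coordinate of the third vertex. -/
theorem IsBarycentric.eq_mul {T : Finset Plane} {lam : Plane → Plane →ᵃ[ℝ] ℝ} {a b c : Plane}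
    (hl : IsBarycentric T lam) (h : HasVertices T a b c) {f : Plane →ᵃ[ℝ] ℝ} (ha : f a = 0)
    (hb : f b = 0) (x : Plane) : f x = lam c x * f c := by
  rw [hl.expand f x, h.sum_eq]; simp [ha, hb]

theorem IsBarycentric.sum_eq_one {T : Finset Plane} {lam : Plane → Plane →ᵃ[ℝ] ℝ}
    (hl : IsBarycentric T lam) (x : Plane) : ∑ p ∈ T, lam p x = 1 := by
  simpa using (hl.expand (AffineMap.const ℝ Plane 1) x).symm

namespace RegularTriangulation

variable {Ω : Set Plane} (𝒯 : RegularTriangulation Ω)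

open Classical in
/-- The barycentric coordinates of the triangle `T` (and the junk value `0` when `T` is not a
triangle of the triangulation). -/
noncomputable def bary (T : Finset Plane) : Plane → Plane →ᵃ[ℝ] ℝ :=
  if h : T ∈ 𝒯.triangles then
    (exists_isBarycentric (𝒯.card_eq_three T h) (𝒯.affineIndependent T h)).choose
  else 0

variable {𝒯} {S T : Finset Plane}

theorem isBarycentric_bary (hT : T ∈ 𝒯.triangles) : IsBarycentric T (𝒯.bary T) := by
  rw [bary, dif_pos hT]
  exact (exists_isBarycentric (𝒯.card_eq_three T hT) (𝒯.affineIndependent T hT)).choose_spec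

/-- Conformity in terms of barycentric coordinates: if a common point of two triangles has a
non-zero coordinate at a vertex of one of them, this vertex belongs to the other one. -/
theorem mem_of_bary_ne_zero (hS : S ∈ 𝒯.triangles) (hT : T ∈ 𝒯.triangles) {x p : Plane}
    (hxS : x ∈ convexHull ℝ (S : Set Plane)) (hxT : x ∈ convexHull ℝ (T : Set Plane))
    (hp : p ∈ T) (hne : 𝒯.bary T p x ≠ 0) : p ∈ S := by
  by_contra hpS
  have hl := isBarycentric_bary hT
  have hx : x ∈ convexHull ℝ ((S : Set Plane) ∩ (T : Set Plane)) := by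
    rw [← 𝒯.inter_eq S hS T hT]; exact ⟨hxS, hxT⟩
  have hconv : Convex ℝ {y | 𝒯.bary T p y = 0} :=
    (convex_singleton (0 : ℝ)).affine_preimage (𝒯.bary T p)
  refine hne (convexHull_min ?_ hconv hx)
  rintro q ⟨hqS, hqT⟩
  exact hl.of_ne p hp q hqT (fun h => hpS (h ▸ hqS))

theorem eq_of_subset (hS : S ∈ 𝒯.triangles) (hT : T ∈ 𝒯.triangles) (h : T ⊆ S) : T = S :=
  Finset.eq_of_subset_of_card_le h (by rw [𝒯.card_eq_three S hS, 𝒯.card_eq_three T hT])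

theorem eq_of_mem_interior (hS : S ∈ 𝒯.triangles) (hT : T ∈ 𝒯.triangles) {x : Plane}
    (hxT : x ∈ interior (convexHull ℝ (T : Set Plane)))
    (hxS : x ∈ convexHull ℝ (S : Set Plane)) : T = S := by
  refine eq_of_subset hS hT fun p hp => mem_of_bary_ne_zero hS hT hxS (interior_subset hxT) hp ?_
  exact (((isBarycentric_bary hT).mem_interior x).1 hxT p hp).ne'

theorem disjoint_interior (hS : S ∈ 𝒯.triangles) (hT : T ∈ 𝒯.triangles) (h : S ≠ T) :
    Disjoint (interior (convexHull ℝ (S : Set Plane))) (interior (convexHull ℝ (T : Set Plane))) :=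
  Set.disjoint_left.2 fun _ hxS hxT => h (eq_of_mem_interior hT hS hxS (interior_subset hxT))

theorem eventually_pos {f : Plane →ᵃ[ℝ] ℝ} {q : Plane} (h : 0 < f q) : ∀ᶠ x in 𝓝 q, 0 < f x :=
  f.continuous_plane.continuousAt.eventually (lt_mem_nhds h)

theorem affine_lineMap (f : Plane →ᵃ[ℝ] ℝ) (p q : Plane) (t : ℝ) :
    f (AffineMap.lineMap p q t) = (1 - t) * f p + t * f q := by
  rw [AffineMap.apply_lineMap, AffineMap.lineMap_apply_ring']; ring

variable {a b c c' : Plane}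

/-- Two distinct triangles with the common side `{a, b}` lie on opposite sides of it. -/
theorem bary_neg_of_common_side (hS : S ∈ 𝒯.triangles) (hT : T ∈ 𝒯.triangles)
    (hvS : HasVertices S a b c') (hvT : HasVertices T a b c) (hne : S ≠ T) :
    𝒯.bary T c c' < 0 := by
  by_contra! hcc
  have hlT := isBarycentric_bary hT
  have hlS := isBarycentric_bary hS
  set q : Plane := AffineMap.lineMap a b (1 / 2 : ℝ) with hq
  -- points close to `q` on the segment from `q` to `c'` would lie in both triangles
  have hcont : Tendsto (fun t : ℝ => (AffineMap.lineMap q c' t : Plane)) (𝓝[>] 0) (𝓝 q) := by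
    have : Continuous fun t : ℝ => (AffineMap.lineMap q c' t : Plane) :=
      AffineMap.lineMap_continuous
    have h := this.tendsto 0
    rw [AffineMap.lineMap_apply_zero] at h
    exact h.mono_left nhdsWithin_le_nhds
  have ha : 0 < 𝒯.bary T a q := by
    rw [hq, affine_lineMap, hlT.self a hvT.mem₁, hlT.of_ne a hvT.mem₁ b hvT.mem₂ hvT.ne₁₂]
    norm_num
  have hb : 0 < 𝒯.bary T b q := by
    rw [hq, affine_lineMap, hlT.self b hvT.mem₂, hlT.of_ne b hvT.mem₂ a hvT.mem₁ hvT.ne₁₂.symm]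
    norm_num
  have hc : 𝒯.bary T c q = 0 := by
    rw [hq, affine_lineMap, hlT.of_ne c hvT.mem₃ b hvT.mem₂ hvT.ne₂₃.symm,
      hlT.of_ne c hvT.mem₃ a hvT.mem₁ hvT.ne₁₃.symm]
    norm_num
  have hlt1 : ∀ᶠ t : ℝ in 𝓝[>] 0, t < 1 := nhdsWithin_le_nhds (gt_mem_nhds one_pos)
  have hgt0 : ∀ᶠ t : ℝ in 𝓝[>] 0, 0 < t := self_mem_nhdsWithin
  obtain ⟨t, hta, htb, ht0, ht1⟩ := ((hcont.eventually (eventually_pos ha)).and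
    ((hcont.eventually (eventually_pos hb)).and (hgt0.and hlt1))).exists
  set x : Plane := AffineMap.lineMap q c' t with hx
  have hxT : x ∈ convexHull ℝ (T : Set Plane) := by
    rw [hlT.mem_hull, hvT.forall_iff]
    refine ⟨hta.le, htb.le, ?_⟩
    rw [hx, affine_lineMap, hc]
    nlinarith
  have hSc : 𝒯.bary S c' x = t := by
    rw [hx, affine_lineMap, hq, affine_lineMap, hlS.self c' hvS.mem₃,
      hlS.of_ne c' hvS.mem₃ a hvS.mem₁ hvS.ne₁₃.symm,
      hlS.of_ne c' hvS.mem₃ b hvS.mem₂ hvS.ne₂₃.symm]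
    ring
  have hxS : x ∈ convexHull ℝ (S : Set Plane) := by
    rw [hlS.mem_hull, hvS.forall_iff]
    refine ⟨?_, ?_, by rw [hSc]; exact ht0.le⟩
    · rw [hx, affine_lineMap, hq, affine_lineMap, hlS.self a hvS.mem₁,
        hlS.of_ne a hvS.mem₁ b hvS.mem₂ hvS.ne₁₂, hlS.of_ne a hvS.mem₁ c' hvS.mem₃ hvS.ne₁₃]
      linarith
    · rw [hx, affine_lineMap, hq, affine_lineMap, hlS.self b hvS.mem₂,
        hlS.of_ne b hvS.mem₂ a hvS.mem₁ hvS.ne₁₂.symm, hlS.of_ne b hvS.mem₂ c' hvS.mem₃ hvS.ne₂₃]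
      linarith
  have hc'T : c' ∈ T := mem_of_bary_ne_zero hT hS hxT hxS hvS.mem₃ (by rw [hSc]; exact ht0.ne')
  rcases (hvT.mem_iff c').1 hc'T with h | h | h
  · exact hvS.ne₁₃ h.symm
  · exact hvS.ne₂₃ h.symm
  · exact hne (hvT.eq_of_eq (h ▸ hvS))

/-- Near a relative interior point `q` of a side `{a, b}` common to two triangles, these triangles
cover the two half-planes bounded by the side. -/
theorem eventually_of_two_triangles (hS : S ∈ 𝒯.triangles) (hT : T ∈ 𝒯.triangles)
    (hvS : HasVertices S a b c') (hvT : HasVertices T a b c) (hne : S ≠ T) {q : Plane}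
    (ha : 0 < 𝒯.bary T a q) (hb : 0 < 𝒯.bary T b q) (hc : 𝒯.bary T c q = 0) :
    ∀ᶠ x in 𝓝 q, (0 ≤ 𝒯.bary T c x → x ∈ convexHull ℝ (T : Set Plane)) ∧
      (0 < 𝒯.bary T c x → x ∈ interior (convexHull ℝ (T : Set Plane))) ∧
      (𝒯.bary T c x < 0 → x ∈ interior (convexHull ℝ (S : Set Plane))) := by
  have hlT := isBarycentric_bary hT
  have hlS := isBarycentric_bary hS
  have hneg : 𝒯.bary S c' c < 0 := bary_neg_of_common_side hT hS hvT hvS hne.symm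
  have hSa : 𝒯.bary S a q = 𝒯.bary T a q := by
    rw [hlT.expand (𝒯.bary S a) q, hvT.sum_eq, hlS.self a hvS.mem₁,
      hlS.of_ne a hvS.mem₁ b hvS.mem₂ hvS.ne₁₂, hc]
    ring
  have hSb : 𝒯.bary S b q = 𝒯.bary T b q := by
    rw [hlT.expand (𝒯.bary S b) q, hvT.sum_eq, hlS.self b hvS.mem₂,
      hlS.of_ne b hvS.mem₂ a hvS.mem₁ hvS.ne₁₂.symm, hc]
    ring
  filter_upwards [eventually_pos ha, eventually_pos hb, eventually_pos (hSa ▸ ha),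
    eventually_pos (hSb ▸ hb)] with x h1 h2 h3 h4
  refine ⟨fun h => ?_, fun h => ?_, fun h => ?_⟩
  · rw [hlT.mem_hull, hvT.forall_iff]
    exact ⟨h1.le, h2.le, h⟩
  · rw [hlT.mem_interior, hvT.forall_iff]
    exact ⟨h1, h2, h⟩
  · rw [hlS.mem_interior, hvS.forall_iff]
    refine ⟨h3, h4, ?_⟩
    rw [hlT.eq_mul hvT (hlS.of_ne c' hvS.mem₃ a hvS.mem₁ hvS.ne₁₃.symm)
      (hlS.of_ne c' hvS.mem₃ b hvS.mem₂ hvS.ne₂₃.symm) x]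
    exact mul_pos_of_neg_of_neg h hneg

theorem isClosed_hull (T : Finset Plane) : IsClosed (convexHull ℝ (T : Set Plane)) :=
  (T.finite_toSet.isCompact_convexHull ℝ).isClosed

/-- Near a relative interior point `q` of a side `{a, b}` of exactly one triangle `T`, the triangle
`T` covers one of the two half-planes bounded by the side, and the other one is free. -/
theorem eventually_of_one_triangle (hT : T ∈ 𝒯.triangles) (hvT : HasVertices T a b c)
    (honly : ∀ S ∈ 𝒯.triangles, a ∈ S → b ∈ S → S = T) {q : Plane}
    (ha : 0 < 𝒯.bary T a q) (hb : 0 < 𝒯.bary T b q) (hc : 𝒯.bary T c q = 0) :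
    ∀ᶠ x in 𝓝 q, (0 < 𝒯.bary T c x → x ∈ interior (convexHull ℝ (T : Set Plane))) ∧
      (𝒯.bary T c x < 0 → ∀ S ∈ 𝒯.triangles, x ∉ convexHull ℝ (S : Set Plane)) := by
  have hlT := isBarycentric_bary hT
  have hqT : q ∈ convexHull ℝ (T : Set Plane) := by
    rw [hlT.mem_hull, hvT.forall_iff]; exact ⟨ha.le, hb.le, hc.ge⟩
  have hfar : ∀ᶠ x in 𝓝 q, ∀ S ∈ 𝒯.triangles, S ≠ T → x ∉ convexHull ℝ (S : Set Plane) := by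
    rw [Filter.eventually_all_finset]
    intro S hS
    by_cases h : S = T
    · simp [h]
    · have : q ∉ convexHull ℝ (S : Set Plane) := fun hqS => h <| honly S hS
        (mem_of_bary_ne_zero hS hT hqS hqT hvT.mem₁ ha.ne')
        (mem_of_bary_ne_zero hS hT hqS hqT hvT.mem₂ hb.ne')
      filter_upwards [(isClosed_hull S).isOpen_compl.mem_nhds this] with x hx _
      exact hx
  filter_upwards [eventually_pos ha, eventually_pos hb, hfar] with x h1 h2 h3
  refine ⟨fun h => ?_, fun h S hS hxS => ?_⟩
  · rw [hlT.mem_interior, hvT.forall_iff]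
    exact ⟨h1, h2, h⟩
  · by_cases hST : S = T
    · subst hST
      exact absurd ((hlT.mem_hull x).1 hxS c hvT.mem₃) (not_le.2 h)
    · exact h3 S hS hST hxS

theorem hull_subset_closure (hT : T ∈ 𝒯.triangles) :
    convexHull ℝ (T : Set Plane) ⊆ closure Ω := by
  rw [← 𝒯.cover]
  exact Set.subset_biUnion_of_mem (u := fun T : Finset Plane => convexHull ℝ (T : Set Plane)) hT

theorem exists_bary_neg_near (hT : T ∈ 𝒯.triangles) (hvT : HasVertices T a b c) {q : Plane}
    (hc : 𝒯.bary T c q = 0) {P : Plane → Prop} (hP : ∀ᶠ x in 𝓝 q, P x) :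
    ∃ x, P x ∧ 𝒯.bary T c x < 0 := by
  have hcont : Tendsto (fun t : ℝ => (AffineMap.lineMap q c t : Plane)) (𝓝[<] 0) (𝓝 q) := by
    have : Continuous fun t : ℝ => (AffineMap.lineMap q c t : Plane) :=
      AffineMap.lineMap_continuous
    have h := this.tendsto 0
    rw [AffineMap.lineMap_apply_zero] at h
    exact h.mono_left nhdsWithin_le_nhds
  obtain ⟨t, ht, ht0⟩ := ((hcont.eventually hP).and self_mem_nhdsWithin).exists
  refine ⟨_, ht, ?_⟩
  have ht0' : t < 0 := ht0
  rw [affine_lineMap, hc, (isBarycentric_bary hT).self c hvT.mem₃]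
  linarith

theorem bary_lineMap_side (hT : T ∈ 𝒯.triangles) (hvT : HasVertices T a b c) (t : ℝ) :
    𝒯.bary T a (AffineMap.lineMap a b t) = 1 - t ∧ 𝒯.bary T b (AffineMap.lineMap a b t) = t ∧
      𝒯.bary T c (AffineMap.lineMap a b t) = 0 := by
  have hlT := isBarycentric_bary hT
  refine ⟨?_, ?_, ?_⟩
  · rw [affine_lineMap, hlT.self a hvT.mem₁, hlT.of_ne a hvT.mem₁ b hvT.mem₂ hvT.ne₁₂]; ring
  · rw [affine_lineMap, hlT.self b hvT.mem₂, hlT.of_ne b hvT.mem₂ a hvT.mem₁ hvT.ne₁₂.symm]; ring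
  · rw [affine_lineMap, hlT.of_ne c hvT.mem₃ b hvT.mem₂ hvT.ne₂₃.symm,
      hlT.of_ne c hvT.mem₃ a hvT.mem₁ hvT.ne₁₃.symm]; ring

/-- A side of only one triangle lies on the boundary. -/
theorem segment_subset_frontier (hΩ : IsOpen Ω) (hT : T ∈ 𝒯.triangles) (hvT : HasVertices T a b c)
    (honly : ∀ S ∈ 𝒯.triangles, a ∈ S → b ∈ S → S = T) : segment ℝ a b ⊆ frontier Ω := by
  rw [← closure_openSegment]
  refine closure_minimal (fun q hq => ?_) isClosed_frontier
  rw [openSegment_eq_image_lineMap] at hq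
  obtain ⟨t, ⟨ht0, ht1⟩, rfl⟩ := hq
  obtain ⟨h1, h2, h3⟩ := bary_lineMap_side hT hvT t
  have hqT : (AffineMap.lineMap a b t : Plane) ∈ convexHull ℝ (T : Set Plane) := by
    rw [(isBarycentric_bary hT).mem_hull, hvT.forall_iff, h1, h2, h3]
    exact ⟨by linarith, ht0.le, le_rfl⟩
  rw [hΩ.frontier_eq]
  refine ⟨hull_subset_closure hT hqT, fun hqΩ => ?_⟩
  obtain ⟨x, ⟨hx1, hx2⟩, hx3⟩ := exists_bary_neg_near hT hvT h3
    ((eventually_of_one_triangle hT hvT honly (by rw [h1]; linarith) (by rw [h2]; exact ht0) h3).and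
      (hΩ.mem_nhds hqΩ))
  have : x ∈ closure Ω := subset_closure hx2
  rw [← 𝒯.cover] at this
  obtain ⟨S, hS, hxS⟩ := Set.mem_iUnion₂.1 this
  exact hx1.2 hx3 S hS hxS

/-- The relative interior of a side of two triangles lies in the interior of `closure Ω`. -/
theorem lineMap_mem_interior_closure (hS : S ∈ 𝒯.triangles) (hT : T ∈ 𝒯.triangles)
    (hvS : HasVertices S a b c') (hvT : HasVertices T a b c) (hne : S ≠ T) {t : ℝ} (ht0 : 0 < t)
    (ht1 : t < 1) : AffineMap.lineMap a b t ∈ interior (closure Ω) := by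
  obtain ⟨h1, h2, h3⟩ := bary_lineMap_side hT hvT t
  rw [mem_interior_iff_mem_nhds]
  filter_upwards [eventually_of_two_triangles hS hT hvS hvT hne (by rw [h1]; linarith)
    (by rw [h2]; exact ht0) h3] with x hx
  rcases le_or_gt 0 (𝒯.bary T c x) with h | h
  · exact hull_subset_closure hT (hx.1 h)
  · exact hull_subset_closure hS (interior_subset (hx.2.2 h))

end RegularTriangulation

/-! ### Sides and nodal patches -/

/-- A Lipschitz domain lies on one side of its boundary only. -/
theorem IsLipschitzDomain.interior_closure {Ω : Set Plane} (hΩ : IsLipschitzDomain Ω) :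
    interior (closure Ω) = Ω := by
  refine subset_antisymm (fun x hx => ?_) (interior_maximal subset_closure hΩ.isOpen)
  by_contra hxΩ
  have hxf : x ∈ frontier Ω := by
    rw [hΩ.isOpen.frontier_eq]; exact ⟨interior_subset hx, hxΩ⟩
  obtain ⟨e, K, g, hg, hev⟩ := hΩ.boundary x hxf
  have hgx : e x 1 ≤ g (e x 0) := not_lt.1 fun h => hxΩ (hev.self_of_nhds.2 h)
  -- move down from `x`, in the direction opposite to the epigraph
  let y : ℝ → Plane := fun t => e.symm (e x + t • EuclideanSpace.single 1 (-1 : ℝ))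
  have hy : Continuous y := e.symm.continuous.comp
    (continuous_const.add (continuous_id.smul continuous_const))
  have hei : ∀ i, Continuous fun z => e z i := fun i =>
    (EuclideanSpace.proj (𝕜 := ℝ) i).continuous.comp e.continuous
  have hy0 : y 0 = x := by simp [y]
  have htend : Tendsto y (𝓝[>] 0) (𝓝 x) := by
    have := hy.tendsto 0
    rw [hy0] at this
    exact this.mono_left nhdsWithin_le_nhds
  have hgt0 : ∀ᶠ t : ℝ in 𝓝[>] 0, 0 < t := self_mem_nhdsWithin
  obtain ⟨t, h1, h2, ht0⟩ := ((htend.eventually (eventually_mem_nhds_iff.2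
    (mem_interior_iff_mem_nhds.1 hx))).and
    ((htend.eventually hev.eventually_nhds).and hgt0)).exists
  have hlt : e (y t) 1 < g (e (y t) 0) := by
    have hey : e (y t) = e x + t • EuclideanSpace.single 1 (-1 : ℝ) := e.apply_symm_apply _
    have h0 : e (y t) 0 = e x 0 := by rw [hey]; simp
    have h1 : e (y t) 1 = e x 1 - t := by rw [hey]; simp [sub_eq_add_neg]
    rw [h0, h1]
    linarith
  have hopen : ∀ᶠ z in 𝓝 (y t), e z 1 < g (e z 0) := by
    exact (hei 1).continuousAt.eventually_lt (hg.continuous.comp (hei 0)).continuousAt hlt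
  have hno : ∀ᶠ z in 𝓝 (y t), z ∉ Ω := by
    filter_upwards [hopen, h2] with z hz1 hz2 hz3
    exact absurd (hz2.1 hz3) (not_lt.2 hz1.le)
  exact (mem_closure_iff_frequently.1 (mem_of_mem_nhds h1)) hno

namespace RegularTriangulation

variable {Ω : Set Plane} {𝒯 : RegularTriangulation Ω} {S T : Finset Plane} {a b c z : Plane}

/-- Let `C` be a non-empty set of triangles at the node `z` such that each side at `z` of a triangle
in `C` is shared with another triangle in `C`. Then these triangles surround `z`: a small circle
about `z` is connected and its part covered by `C` is both closed and open. -/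
theorem biUnion_mem_nhds_of_closed_fan {C : Finset (Finset Plane)} (hC : C ⊆ 𝒯.trianglesAt z)
    (hne : C.Nonempty)
    (hside : ∀ T ∈ C, ∀ b ∈ T, b ≠ z → ∃ S ∈ C, S ≠ T ∧ b ∈ S) :
    (⋃ T ∈ C, convexHull ℝ (T : Set Plane)) ∈ 𝓝 z := by
  have hCT : ∀ T ∈ C, T ∈ 𝒯.triangles ∧ z ∈ T := fun T hT => by
    simpa [trianglesAt] using hC hT
  set K := ⋃ T ∈ C, convexHull ℝ (T : Set Plane) with hK
  have hKcl : IsClosed K := isClosed_biUnion_finset fun T _ => isClosed_hull T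
  have hsub : ∀ T ∈ C, convexHull ℝ (T : Set Plane) ⊆ K := fun T hT =>
    Set.subset_biUnion_of_mem (u := fun T : Finset Plane => convexHull ℝ (T : Set Plane)) hT
  have hpos : ∀ᶠ q in 𝓝 z, ∀ T ∈ C, 0 < 𝒯.bary T z q := by
    rw [Filter.eventually_all_finset]
    intro T hT
    refine eventually_pos ?_
    rw [(isBarycentric_bary (hCT T hT).1).self z (hCT T hT).2]
    exact one_pos
  -- each point of `K` near `z`, except `z`, is an interior point of `K`
  have hint : ∀ q, q ≠ z → (∀ T ∈ C, 0 < 𝒯.bary T z q) → q ∈ K → q ∈ interior K := by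
    intro q hqz hq hqK
    obtain ⟨T, hT, hqT⟩ := Set.mem_iUnion₂.1 hqK
    obtain ⟨hT1, hT2⟩ := hCT T hT
    obtain ⟨b, c, hv⟩ := exists_hasVertices_of_mem (𝒯.card_eq_three T hT1) hT2
    have hl := isBarycentric_bary hT1
    have hnn := (hl.mem_hull q).1 hqT
    -- a point with vanishing coordinate opposite to the side `{z, b}`
    have key : ∀ {b c}, HasVertices T z b c → 𝒯.bary T c q = 0 → q ∈ interior K := by
      intro b c hv hc0
      have hb0 : 0 < 𝒯.bary T b q := by
        refine lt_of_le_of_ne (hnn b hv.mem₂) fun hb0 => hqz ?_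
        have hz1 : 𝒯.bary T z q = 1 := by
          have := hl.sum_eq_one q
          rw [hv.sum_eq, ← hb0, hc0] at this
          linarith
        have hcoord : ∀ f : Plane →ᵃ[ℝ] ℝ, f q = f z := fun f => by
          rw [hl.expand f q, hv.sum_eq, ← hb0, hc0, hz1]; ring
        ext i
        exact hcoord (EuclideanSpace.proj (𝕜 := ℝ) i : Plane →L[ℝ] ℝ).toLinearMap.toAffineMap
      obtain ⟨S, hS, hST, hbS⟩ := hside T hT b hv.mem₂ hv.ne₁₂.symm
      obtain ⟨hS1, hS2⟩ := hCT S hS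
      obtain ⟨c', hvS⟩ := exists_hasVertices (𝒯.card_eq_three S hS1) hS2 hbS hv.ne₁₂
      rw [mem_interior_iff_mem_nhds]
      filter_upwards [eventually_of_two_triangles hS1 hT1 hvS hv hST (hq T hT) hb0 hc0] with x hx
      rcases le_or_gt 0 (𝒯.bary T c x) with h | h
      · exact hsub T hT (hx.1 h)
      · exact hsub S hS (interior_subset (hx.2.2 h))
    by_cases hc0 : 𝒯.bary T c q = 0
    · exact key hv hc0
    by_cases hb0 : 𝒯.bary T b q = 0
    · exact key hv.rotate.rotate.swap hb0
    refine interior_mono (hsub T hT) ((hl.mem_interior q).2 ?_)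
    rw [hv.forall_iff]
    exact ⟨hq T hT, lt_of_le_of_ne (hnn b hv.mem₂) (Ne.symm hb0),
      lt_of_le_of_ne (hnn c hv.mem₃) (Ne.symm hc0)⟩
  obtain ⟨ε, hε, hball⟩ := Metric.eventually_nhds_iff.1 hpos
  obtain ⟨T, hT⟩ := hne
  obtain ⟨hT1, hT2⟩ := hCT T hT
  obtain ⟨b, c, hv⟩ := exists_hasVertices_of_mem (𝒯.card_eq_three T hT1) hT2
  have hbz : 0 < ‖b - z‖ := norm_pos_iff.2 (sub_ne_zero.2 hv.ne₁₂.symm)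
  have hrank : 1 < Module.rank ℝ Plane := by
    rw [← Module.finrank_eq_rank]; simp
  refine Metric.mem_nhds_iff.2 ⟨min ε ‖b - z‖, lt_min hε hbz, fun x hx => ?_⟩
  have hzK : z ∈ K := hsub T hT (subset_convexHull ℝ _ hT2)
  by_cases hxz : x = z
  · exact hxz ▸ hzK
  set r := dist x z with hr
  have hr0 : 0 < r := dist_pos.2 hxz
  have hrε : r < ε := (Metric.mem_ball.1 hx).trans_le (min_le_left _ _)
  have hrb : r < ‖b - z‖ := (Metric.mem_ball.1 hx).trans_le (min_le_right _ _)
  have hsph : ∀ q ∈ Metric.sphere z r, q ∈ K → q ∈ interior K := fun q hq hqK => by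
    have hq' : dist q z = r := hq
    refine hint q (fun h => ?_) (hball (by rw [hq']; exact hrε)) hqK
    rw [h, dist_self] at hq'
    exact hr0.ne hq'
  have hsubset := (isPreconnected_sphere hrank z r).subset_left_of_subset_union
    (isOpen_interior (s := K)) hKcl.isOpen_compl
    (Set.disjoint_compl_right_iff_subset.2 interior_subset)
    (fun q hq => by
      by_cases h : q ∈ K
      · exact Or.inl (hsph q hq h)
      · exact Or.inr h) ?_
  · exact interior_subset (hsubset (Metric.mem_sphere.2 rfl))
  · have hmem : (AffineMap.lineMap z b (r / ‖b - z‖) : Plane) ∈ Metric.sphere z r := by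
      rw [Metric.mem_sphere, dist_lineMap_left, Real.norm_of_nonneg (by positivity), dist_comm,
        dist_eq_norm, div_mul_cancel₀ _ hbz.ne']
    refine ⟨_, hmem, hsph _ hmem (hsub T hT ?_)⟩
    refine (convex_convexHull ℝ _).segment_subset (subset_convexHull ℝ _ hT2)
      (subset_convexHull ℝ _ hv.mem₂) ?_
    rw [segment_eq_image_lineMap]
    exact ⟨_, ⟨by positivity, (div_le_one hbz).2 hrb.le⟩, rfl⟩

/-- A closed fan of triangles at a node, as in `biUnion_mem_nhds_of_closed_fan`, consists of all the
triangles at this node. -/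
theorem eq_trianglesAt_of_closed_fan {C : Finset (Finset Plane)} (hC : C ⊆ 𝒯.trianglesAt z)
    (hne : C.Nonempty)
    (hside : ∀ T ∈ C, ∀ b ∈ T, b ≠ z → ∃ S ∈ C, S ≠ T ∧ b ∈ S) : C = 𝒯.trianglesAt z := by
  refine subset_antisymm hC fun T hT => ?_
  have hT' : T ∈ 𝒯.triangles ∧ z ∈ T := by simpa [trianglesAt] using hT
  have hcl : z ∈ closure (interior (convexHull ℝ (T : Set Plane))) := by
    have hne : (interior (convexHull ℝ (T : Set Plane))).Nonempty := by
      have h1 := 𝒯.affineIndependent T hT'.1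
      rw [interior_convexHull_nonempty_iff_affineSpan_eq_top]
      have := h1.affineSpan_eq_top_iff_card_eq_finrank_add_one
      rw [Subtype.range_coe] at this
      exact this.2 (by simp [𝒯.card_eq_three T hT'.1])
    rw [(convex_convexHull ℝ _).closure_interior_eq_closure_of_nonempty_interior hne]
    exact subset_closure (subset_convexHull ℝ _ hT'.2)
  obtain ⟨x, hx1, hx2⟩ := mem_closure_iff_nhds.1 hcl _
    (biUnion_mem_nhds_of_closed_fan hC hne hside)
  obtain ⟨S, hS, hxS⟩ := Set.mem_iUnion₂.1 hx1
  have hS' : S ∈ 𝒯.triangles ∧ z ∈ S := by simpa [trianglesAt] using hC hS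
  exact eq_of_mem_interior hS'.1 hT'.1 hx2 hxS ▸ hS

/-- A node with a closed fan of triangles is an interior node. -/
theorem mem_of_closed_fan (hΩ : IsLipschitzDomain Ω) {C : Finset (Finset Plane)}
    (hC : C ⊆ 𝒯.trianglesAt z) (hne : C.Nonempty)
    (hside : ∀ T ∈ C, ∀ b ∈ T, b ≠ z → ∃ S ∈ C, S ≠ T ∧ b ∈ S) : z ∈ Ω := by
  rw [← hΩ.interior_closure, mem_interior_iff_mem_nhds]
  refine mem_of_superset (biUnion_mem_nhds_of_closed_fan hC hne hside) ?_
  refine Set.iUnion₂_subset fun T hT => hull_subset_closure (𝒯 := 𝒯) ?_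
  have : T ∈ 𝒯.triangles ∧ z ∈ T := by simpa [trianglesAt] using hC hT
  exact this.1

/-- A side at a node in `Ω` belongs to two triangles. -/
theorem exists_neighbour_of_mem (hΩ : IsOpen Ω) (hT : T ∈ 𝒯.triangles)
    (hvT : HasVertices T z b c) (hz : z ∈ Ω) :
    ∃ S ∈ 𝒯.triangles, S ≠ T ∧ z ∈ S ∧ b ∈ S := by
  by_contra! h
  have := segment_subset_frontier hΩ hT hvT
    (fun S hS h1 h2 => by_contra fun hne => h S hS hne h1 h2) (left_mem_segment ℝ z b)
  rw [hΩ.frontier_eq] at this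
  exact this.2 hz

open Classical in
theorem mem_sides (hT : T ∈ 𝒯.triangles) (hvT : HasVertices T a b c) :
    ({a, b} : Finset Plane) ∈ 𝒯.sides := by
  refine ⟨Finset.card_pair hvT.ne₁₂, T, hT, ?_⟩
  intro p hp
  rw [Finset.mem_insert, Finset.mem_singleton] at hp
  rw [hvT.mem_iff]; tauto

/-- The condition in `CR10` at the midpoint of a side shared by two triangles. -/
theorem CR10.midpoint_eq (hΩ : IsLipschitzDomain Ω) {v : 𝒯.P1} (hv : v ∈ 𝒯.CR10)
    {S T : 𝒯.triangles} {c' : Plane} (hvS : HasVertices S.1 a b c')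
    (hvT : HasVertices T.1 a b c) : v S (midpoint ℝ a b) = v T (midpoint ℝ a b) := by
  classical
  by_cases hne : S = T
  · rw [hne]
  have hne' : S.1 ≠ T.1 := fun h => hne (Subtype.ext h)
  refine hv.1 a b {a, b} ⟨mem_sides T.2 hvT, fun hb => ?_⟩ (by simp) S T ?_ ?_
  · have hm := lineMap_mem_interior_closure S.2 T.2 hvS hvT hne' (t := 1 / 2)
      (by norm_num) (by norm_num)
    rw [hΩ.interior_closure] at hm
    have hf : (AffineMap.lineMap a b (1 / 2 : ℝ) : Plane) ∈ frontier Ω := by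
      refine hb.2 ?_
      rw [Finset.coe_pair, convexHull_pair, segment_eq_image_lineMap]
      exact ⟨1 / 2, by norm_num, rfl⟩
    rw [hΩ.isOpen.frontier_eq] at hf
    exact hf.2 hm
  · intro p hp
    rw [Finset.mem_insert, Finset.mem_singleton] at hp
    rw [hvS.mem_iff]; tauto
  · intro p hp
    rw [Finset.mem_insert, Finset.mem_singleton] at hp
    rw [hvT.mem_iff]; tauto

/-- The condition in `CR10` at the midpoint of a side of only one triangle. -/
theorem CR10.midpoint_eq_zero (hΩ : IsLipschitzDomain Ω) {v : 𝒯.P1} (hv : v ∈ 𝒯.CR10)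
    {T : 𝒯.triangles} (hvT : HasVertices T.1 a b c)
    (honly : ∀ S ∈ 𝒯.triangles, a ∈ S → b ∈ S → S = T) : v T (midpoint ℝ a b) = 0 := by
  classical
  refine hv.2 a b {a, b} ⟨mem_sides T.2 hvT, ?_⟩ (by simp) T ?_
  · rw [Finset.coe_pair, convexHull_pair]
    exact segment_subset_frontier hΩ.isOpen T.2 hvT honly
  · intro p hp
    rw [Finset.mem_insert, Finset.mem_singleton] at hp
    rw [hvT.mem_iff]; tauto

end RegularTriangulation

/-! ### Functions in `H¹₀` do not jump -/

theorem eLpNorm_two_sq {α F : Type*} [MeasurableSpace α] [NormedAddCommGroup F] (f : α → F)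
    (μ : Measure α) : eLpNorm f 2 μ ^ 2 = ∫⁻ x, ‖f x‖ₑ ^ 2 ∂μ := by
  have := eLpNorm_nnreal_pow_eq_lintegral (f := f) (μ := μ) (p := 2) two_ne_zero
  simpa using this

theorem enorm_gradient_eq (φ : Plane → ℝ) (x : Plane) : ‖gradient φ x‖ₑ = ‖fderiv ℝ φ x‖ₑ := by
  rw [gradient, ← ofReal_norm, LinearIsometryEquiv.norm_map, ofReal_norm]

/-- The difference quotients of a `C¹` function are bounded in `L²` by its gradient. -/
theorem eLpNorm_sub_translate_le {φ : Plane → ℝ} (hφ : ContDiff ℝ 1 φ) (h : Plane) :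
    eLpNorm (fun x => φ (x + h) - φ x) 2 volume ≤ ‖h‖ₑ * eLpNorm (gradient φ) 2 volume := by
  have hcont : Continuous (fderiv ℝ φ) := hφ.continuous_fderiv one_ne_zero
  set μ : Measure ℝ := volume.restrict (Set.Icc 0 1) with hμ
  have hprob : IsProbabilityMeasure μ := ⟨by simp [hμ]⟩
  -- the fundamental theorem of calculus and Jensen's inequality along the segment
  have hpt : ∀ x, ‖φ (x + h) - φ x‖ₑ ^ 2 ≤ ∫⁻ s, ‖h‖ₑ ^ 2 * ‖fderiv ℝ φ (x + s • h)‖ₑ ^ 2 ∂μ := by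
    intro x
    set γ : ℝ → ℝ := fun s => φ (x + s • h) with hγ
    have hline : ContDiff ℝ 1 fun s : ℝ => x + s • h := by fun_prop
    have hγc : ContDiff ℝ 1 γ := hφ.comp hline
    have hderiv : ∀ s, deriv γ s = fderiv ℝ φ (x + s • h) h := fun s => by
      have h1 : HasDerivAt (fun s : ℝ => x + s • h) h s := by
        simpa using ((hasDerivAt_id s).smul_const h).const_add x
      exact (((hφ.differentiable one_ne_zero) _).hasFDerivAt.comp_hasDerivAt s h1).deriv
    have h1 : ‖φ (x + h) - φ x‖ₑ ≤ eLpNorm (deriv γ) 1 μ := by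
      have := enorm_sub_le_lintegral_deriv_of_contDiffOn_Icc (f := γ) (a := 0) (b := 1)
        hγc.contDiffOn zero_le_one
      rw [eLpNorm_one_eq_lintegral_enorm]
      simpa [hγ] using this
    have h2 : eLpNorm (deriv γ) 1 μ ≤ eLpNorm (deriv γ) 2 μ :=
      eLpNorm_le_eLpNorm_of_exponent_le one_le_two
        (hγc.continuous_deriv le_rfl).aestronglyMeasurable
    calc ‖φ (x + h) - φ x‖ₑ ^ 2 ≤ eLpNorm (deriv γ) 2 μ ^ 2 := by gcongr; exact h1.trans h2
      _ = ∫⁻ s, ‖deriv γ s‖ₑ ^ 2 ∂μ := eLpNorm_two_sq _ _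
      _ ≤ _ := by
        refine lintegral_mono fun s => ?_
        rw [← mul_pow, hderiv, mul_comm]
        gcongr
        exact ContinuousLinearMap.le_opENorm _ _
  rw [← ENNReal.pow_le_pow_left_iff two_ne_zero, mul_pow, eLpNorm_two_sq, eLpNorm_two_sq]
  calc ∫⁻ x, ‖φ (x + h) - φ x‖ₑ ^ 2
      ≤ ∫⁻ x, ∫⁻ s, ‖h‖ₑ ^ 2 * ‖fderiv ℝ φ (x + s • h)‖ₑ ^ 2 ∂μ := lintegral_mono hpt
    _ = ∫⁻ s, ∫⁻ x, ‖h‖ₑ ^ 2 * ‖fderiv ℝ φ (x + s • h)‖ₑ ^ 2 ∂volume ∂μ := by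
        refine lintegral_lintegral_swap (Measurable.aemeasurable ?_)
        have : Continuous fun p : Plane × ℝ => fderiv ℝ φ (p.1 + p.2 • h) :=
          hcont.comp (by fun_prop)
        exact (this.enorm.measurable.pow_const 2).const_mul _
    _ = ∫⁻ s, ‖h‖ₑ ^ 2 * ∫⁻ x, ‖gradient φ x‖ₑ ^ 2 ∂volume ∂μ := by
        refine lintegral_congr fun s => ?_
        rw [lintegral_const_mul' _ _ (by simp)]
        congr 1
        rw [lintegral_add_right_eq_self (fun x => ‖fderiv ℝ φ x‖ₑ ^ 2) (s • h)]
        simp_rw [enorm_gradient_eq]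
    _ = _ := by simp

/-- The translates of (the extension by zero of) an `H¹₀` function depend on the shift in a
Lipschitz way, with respect to the `L²` norm. -/
theorem MemH10.exists_translate_le {Ω : Set Plane} {u : Plane → ℝ} (hΩ : MeasurableSet Ω)
    (hu : MemH10 Ω u) : ∃ C : ℝ≥0∞, C ≠ ⊤ ∧ ∀ h : Plane,
      eLpNorm (fun x => Ω.indicator u (x + h) - Ω.indicator u x) 2 volume ≤ C * ‖h‖ₑ := by
  obtain ⟨hu2, g, hg, φ, hφ, hlim, hlimg⟩ := hu
  refine ⟨eLpNorm g 2 (volume.restrict Ω), hg.2.ne, fun h => ?_⟩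
  set U := Ω.indicator u with hU
  have hUm : AEStronglyMeasurable U volume :=
    (aestronglyMeasurable_indicator_iff hΩ).2 hu2.1
  have hφm : ∀ n, AEStronglyMeasurable (φ n) volume := fun n =>
    (hφ n).1.continuous.aestronglyMeasurable
  set ε : ℕ → ℝ≥0∞ := fun n => eLpNorm (fun x => φ n x - u x) 2 (volume.restrict Ω) with hε
  have hdiff : ∀ n, eLpNorm (φ n - U) 2 volume = ε n := fun n => by
    have : φ n - U = Ω.indicator fun x => φ n x - u x := by
      ext x
      by_cases hx : x ∈ Ω
      · simp [hU, hx]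
      · simp [hU, hx, image_eq_zero_of_notMem_tsupport fun hx' => hx ((hφ n).2.2 hx')]
    rw [this, eLpNorm_indicator_eq_eLpNorm_restrict hΩ]
  have hgrad : ∀ n, eLpNorm (gradient (φ n)) 2 volume =
      eLpNorm (gradient (φ n)) 2 (volume.restrict Ω) := fun n => by
    rw [← eLpNorm_indicator_eq_eLpNorm_restrict hΩ]
    congr 1
    ext1 x
    by_cases hx : x ∈ Ω
    · simp [hx]
    · have : fderiv ℝ (φ n) x = 0 := image_eq_zero_of_notMem_tsupport fun hx' =>
        hx ((hφ n).2.2 (tsupport_fderiv_subset ℝ hx'))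
      simp [hx, gradient, this]
  have hgradm : ∀ n, AEStronglyMeasurable (gradient (φ n)) (volume.restrict Ω) := fun n => by
    have h1 : Continuous (fderiv ℝ (φ n)) := (hφ n).1.continuous_fderiv (by simp)
    exact ((InnerProductSpace.toDual ℝ Plane).symm.continuous.comp h1).aestronglyMeasurable
  have hbound : ∀ n, eLpNorm (fun x => U (x + h) - U x) 2 volume ≤
      ε n + ‖h‖ₑ * (eLpNorm (fun x => gradient (φ n) x - g x) 2 (volume.restrict Ω) +
        eLpNorm g 2 (volume.restrict Ω)) + ε n := fun n => by
    have hmp : MeasurePreserving (fun x : Plane => x + h) volume volume :=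
      measurePreserving_add_right _ h
    have hdm : AEStronglyMeasurable (φ n - U) volume := (hφm n).sub hUm
    have e : (fun x => U (x + h) - U x) =
        (-((φ n - U) ∘ fun x => x + h) + fun x => φ n (x + h) - φ n x) + (φ n - U) := by
      ext x; simp
    have hm1 := (hdm.comp_measurePreserving hmp).neg
    have hm2 : AEStronglyMeasurable (fun x => φ n (x + h) - φ n x) volume :=
      ((hφm n).comp_measurePreserving hmp).sub (hφm n)
    rw [e]
    refine (eLpNorm_add_le (hm1.add hm2) hdm one_le_two).trans ?_
    rw [hdiff]
    gcongr
    refine (eLpNorm_add_le hm1 hm2 one_le_two).trans ?_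
    rw [eLpNorm_neg, eLpNorm_comp_measurePreserving hdm hmp, hdiff]
    gcongr
    refine (eLpNorm_sub_translate_le ((hφ n).1.of_le (by simp)) h).trans ?_
    gcongr
    rw [hgrad]
    have e2 : gradient (φ n) = (fun x => gradient (φ n) x - g x) + g := by ext1 x; simp
    calc eLpNorm (gradient (φ n)) 2 (volume.restrict Ω)
        = eLpNorm ((fun x => gradient (φ n) x - g x) + g) 2 (volume.restrict Ω) := by rw [← e2]
      _ ≤ _ := eLpNorm_add_le ((hgradm n).sub hg.1) hg.1 one_le_two
  have hl : Tendsto (fun n => ε n + ‖h‖ₑ * (eLpNorm (fun x => gradient (φ n) x - g x) 2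
      (volume.restrict Ω) + eLpNorm g 2 (volume.restrict Ω)) + ε n) atTop
      (𝓝 (0 + ‖h‖ₑ * (0 + eLpNorm g 2 (volume.restrict Ω)) + 0)) := by
    refine (hlim.add (ENNReal.Tendsto.const_mul (hlimg.add tendsto_const_nhds) ?_)).add hlim
    exact Or.inr enorm_ne_top
  have := ge_of_tendsto' hl hbound
  simpa [mul_comm] using this

/-- If the translates of `U` depend on the shift in an `L²`-Lipschitz way, then `U` cannot jump
across the line `ℓ = 0`: a jump at `q` would contribute at least a constant times `t` to the square
of the `L²` distance of `U` and its translate by `t • h`. -/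
theorem eq_of_translate_le {U : Plane → ℝ} {C : ℝ≥0∞} (hC : C ≠ ⊤)
    (hU : ∀ h : Plane, eLpNorm (fun x => U (x + h) - U x) 2 volume ≤ C * ‖h‖ₑ)
    {ℓ : Plane →ᵃ[ℝ] ℝ} {q c : Plane} (hq : ℓ q = 0) (hc : ℓ c = 1) {α β : Plane → ℝ}
    (hα : ContinuousAt α q) (hβ : ContinuousAt β q)
    (hev : ∀ᶠ x in 𝓝 q, (0 < ℓ x → U x = α x) ∧ (ℓ x < 0 → U x = β x)) : α q = β q := by
  by_contra hne
  set δ := |α q - β q| with hδ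
  have hδ0 : 0 < δ := abs_pos.2 (sub_ne_zero.2 hne)
  have hd4 : 0 < δ / 4 := by positivity
  have hnear : ∀ᶠ x in 𝓝 q, ((0 < ℓ x → U x = α x) ∧ (ℓ x < 0 → U x = β x)) ∧
      |α x - α q| < δ / 4 ∧ |β x - β q| < δ / 4 :=
    hev.and ((Metric.continuousAt_iff'.1 hα _ hd4).and (Metric.continuousAt_iff'.1 hβ _ hd4))
  obtain ⟨ρ, hρ, hball⟩ := Metric.eventually_nhds_iff.1 hnear
  set h : Plane := c - q with hh
  have hℓ : ∀ (x : Plane) (t : ℝ), ℓ (x + t • h) = ℓ x + t := fun x t => by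
    have h1 : ℓ.linear h = 1 := by
      have := ℓ.linearMap_vsub c q
      rw [vsub_eq_sub, vsub_eq_sub, hc, hq, sub_zero] at this
      exact this
    have := ℓ.map_vadd x (t • h)
    rw [vadd_eq_add, vadd_eq_add, map_smul, h1, smul_eq_mul, mul_one] at this
    rw [add_comm x, this, add_comm]
  have hℓc := ℓ.continuous_plane
  set τ : ℝ := ρ / (4 * (‖h‖ + 1)) with hτ
  have hτ0 : 0 < τ := by positivity
  have hτh : τ * ‖h‖ ≤ ρ / 4 := by
    have h1 : τ * (‖h‖ + 1) = ρ / 4 := by rw [hτ]; field_simp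
    nlinarith [norm_nonneg h]
  set A' : Set Plane := Metric.ball q (ρ / 4) ∩ {x | -τ < ℓ x ∧ ℓ x < 0} with hA'
  have hA'open : IsOpen A' := Metric.isOpen_ball.inter
    ((isOpen_lt continuous_const hℓc).inter (isOpen_lt hℓc continuous_const))
  have hA'pos : volume A' ≠ 0 := by
    have hne' : A'.Nonempty := by
      refine ⟨q + (-(τ / 2)) • h, ?_, ?_⟩
      · rw [mem_ball_iff_norm, add_sub_cancel_left, norm_smul, Real.norm_eq_abs, abs_neg,
          abs_of_pos (by positivity)]
        nlinarith [norm_nonneg h]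
      · change -τ < ℓ _ ∧ ℓ _ < 0
        rw [hℓ, hq]
        constructor <;> linarith
    exact (hA'open.measure_pos volume hne').ne'
  -- `A'` is covered by `N` translates of a strip of width `τ / N`, on which the jump is seen
  have main : ∀ N : ℕ, N * (ENNReal.ofReal (δ / 2) ^ 2 * volume A') ≤ (C * ‖(2 * τ) • h‖ₑ) ^ 2 := by
    intro N
    rcases Nat.eq_zero_or_pos N with rfl | hN
    · simp
    have hNr : (0 : ℝ) < N := by exact_mod_cast hN
    set t : ℝ := τ / N with ht
    have ht0 : 0 < t := by positivity
    have hNt : N * t = τ := by rw [ht]; field_simp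
    have htτ : t ≤ τ := by
      have : (1 : ℝ) ≤ N := by exact_mod_cast hN
      nlinarith
    set A : Set Plane := Metric.ball q (ρ / 2) ∩ {x | -t ≤ ℓ x ∧ ℓ x < 0} with hA
    have hAm : MeasurableSet A := Metric.isOpen_ball.measurableSet.inter
      ((isClosed_le continuous_const hℓc).measurableSet.inter
        (isOpen_lt hℓc continuous_const).measurableSet)
    have hcover : A' ⊆ ⋃ i ∈ Finset.range N, (fun x => x + ((i : ℝ) * t) • h) ⁻¹' A := by
      rintro x ⟨hx1, hx2, hx3⟩
      set m := ⌈-ℓ x / t⌉₊ with hm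
      have hm0 : 0 < m := Nat.ceil_pos.2 (div_pos (by linarith) ht0)
      have hm1 : -ℓ x ≤ m * t := by
        rw [← div_le_iff₀ ht0]; exact Nat.le_ceil _
      have hm2 : ((m : ℝ) - 1) * t < -ℓ x := by
        rw [← lt_div_iff₀ ht0]
        have := Nat.ceil_lt_add_one (div_pos (by linarith : 0 < -ℓ x) ht0).le
        linarith
      have hmN : m ≤ N := by
        refine Nat.ceil_le.2 ?_
        rw [div_le_iff₀ ht0, hNt]; linarith
      have hcast : ((m - 1 : ℕ) : ℝ) = m - 1 := by
        rw [Nat.cast_sub hm0, Nat.cast_one]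
      refine Set.mem_iUnion₂.2 ⟨m - 1, Finset.mem_range.2 (by omega), ?_⟩
      rw [hcast]
      have hm3 : 0 ≤ ((m : ℝ) - 1) * t := by
        have : (1 : ℝ) ≤ m := by exact_mod_cast hm0
        nlinarith
      constructor
      · have h1 : dist x q < ρ / 4 := hx1
        rw [Metric.mem_ball]
        calc dist (x + (((m : ℝ) - 1) * t) • h) q
            ≤ dist (x + (((m : ℝ) - 1) * t) • h) x + dist x q := dist_triangle _ _ _
          _ = (((m : ℝ) - 1) * t) * ‖h‖ + dist x q := by
            rw [dist_eq_norm, add_sub_cancel_left, norm_smul, Real.norm_of_nonneg hm3]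
          _ ≤ τ * ‖h‖ + dist x q := by
            gcongr; linarith
          _ < ρ / 2 := by linarith
      · change -t ≤ ℓ _ ∧ ℓ _ < 0
        rw [hℓ]
        constructor <;> linarith
    have hvol : volume A' ≤ N * volume A := by
      calc volume A' ≤ ∑ i ∈ Finset.range N, volume ((fun x => x + ((i : ℝ) * t) • h) ⁻¹' A) :=
            (measure_mono hcover).trans (measure_biUnion_finset_le _ _)
        _ = N * volume A := by simp [measure_preimage_add_right]
    have hjump : ENNReal.ofReal (δ / 2) ^ 2 * volume A ≤ (C * ‖(2 * t) • h‖ₑ) ^ 2 := by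
      calc ENNReal.ofReal (δ / 2) ^ 2 * volume A
          = ∫⁻ _ in A, ENNReal.ofReal (δ / 2) ^ 2 := (setLIntegral_const _ _).symm
        _ ≤ ∫⁻ x in A, ‖U (x + (2 * t) • h) - U x‖ₑ ^ 2 := by
            refine setLIntegral_mono' hAm ?_
            rintro x ⟨hx1, hx2, hx3⟩
            have hx1' : dist x q < ρ / 2 := hx1
            have hy : dist (x + (2 * t) • h) q < ρ := by
              calc dist (x + (2 * t) • h) q
                  ≤ dist (x + (2 * t) • h) x + dist x q := dist_triangle _ _ _
                _ = 2 * (t * ‖h‖) + dist x q := by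
                  rw [dist_eq_norm, add_sub_cancel_left, norm_smul,
                    Real.norm_of_nonneg (by positivity)]
                  ring
                _ ≤ 2 * (τ * ‖h‖) + dist x q := by gcongr
                _ < ρ := by linarith
            obtain ⟨⟨e1, -⟩, b1, -⟩ := hball hy
            obtain ⟨⟨-, e2⟩, -, b2⟩ := hball (by linarith : dist x q < ρ)
            have e1' := e1 (by rw [hℓ]; linarith)
            have e2' := e2 hx3
            gcongr
            rw [Real.enorm_eq_ofReal_abs]
            refine ENNReal.ofReal_le_ofReal ?_
            rw [e1', e2']
            have : δ ≤ |α (x + (2 * t) • h) - β x| + |α (x + (2 * t) • h) - α q| + |β x - β q| := by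
              have e : α q - β q = (α (x + (2 * t) • h) - β x) - (α (x + (2 * t) • h) - α q)
                + (β x - β q) := by ring
              rw [hδ, e]
              exact (abs_add_le _ _).trans (add_le_add_left (abs_sub _ _) _)
            linarith
        _ ≤ ∫⁻ x, ‖U (x + (2 * t) • h) - U x‖ₑ ^ 2 := setLIntegral_le_lintegral _ _
        _ = eLpNorm (fun x => U (x + (2 * t) • h) - U x) 2 volume ^ 2 := (eLpNorm_two_sq _ _).symm
        _ ≤ _ := by gcongr; exact hU _
    have hscale : (N : ℝ≥0∞) * ‖(2 * t) • h‖ₑ = ‖(2 * τ) • h‖ₑ := by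
      have : (2 * τ) • h = (N : ℝ) • ((2 * t) • h) := by
        rw [smul_smul, ← hNt]; congr 1; ring
      rw [this, enorm_smul (N : ℝ)]
      congr 1
      rw [Real.enorm_eq_ofReal_abs, abs_of_pos hNr, ENNReal.ofReal_natCast]
    calc N * (ENNReal.ofReal (δ / 2) ^ 2 * volume A')
        ≤ N * (ENNReal.ofReal (δ / 2) ^ 2 * (N * volume A)) := by gcongr
      _ = (N : ℝ≥0∞) ^ 2 * (ENNReal.ofReal (δ / 2) ^ 2 * volume A) := by ring
      _ ≤ (N : ℝ≥0∞) ^ 2 * (C * ‖(2 * t) • h‖ₑ) ^ 2 := by gcongr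
      _ = (C * (N * ‖(2 * t) • h‖ₑ)) ^ 2 := by ring
      _ = _ := by rw [hscale]
  obtain ⟨N, hN⟩ := ENNReal.exists_nat_mul_gt
    (a := ENNReal.ofReal (δ / 2) ^ 2 * volume A') (b := (C * ‖(2 * τ) • h‖ₑ) ^ 2)
    (mul_ne_zero (pow_ne_zero 2 (by simpa using hδ0)) hA'pos)
    (ENNReal.pow_ne_top (ENNReal.mul_ne_top hC enorm_ne_top))
  exact absurd (main N) (not_le.2 hN)

/-! ### Nodal values of conforming functions -/

namespace RegularTriangulation

variable {Ω : Set Plane} {𝒯 : RegularTriangulation Ω} {a b c c' z : Plane}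

theorem piecewise_of_mem_interior {F : Type*} [AddCommMonoid F] (f : 𝒯.triangles → Plane → F)
    (T : 𝒯.triangles) {x : Plane} (hx : x ∈ interior (convexHull ℝ (T.1 : Set Plane))) :
    𝒯.piecewise f x = f T x := by
  rw [piecewise, Finset.sum_eq_single T]
  · rw [Set.indicator_of_mem hx]
  · intro S _ hS
    refine Set.indicator_of_notMem (fun hxS => hS (Subtype.ext ?_)) _
    exact eq_of_mem_interior T.2 S.2 hxS (interior_subset hx)
  · simp

theorem piecewise_of_notMem {F : Type*} [AddCommMonoid F] (f : 𝒯.triangles → Plane → F)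
    {x : Plane} (hx : ∀ T ∈ 𝒯.triangles, x ∉ interior (convexHull ℝ (T : Set Plane))) :
    𝒯.piecewise f x = 0 :=
  Finset.sum_eq_zero fun T _ => Set.indicator_of_notMem (hx T.1 T.2) _

theorem interior_hull_subset (hΩ : IsLipschitzDomain Ω) {T : Finset Plane}
    (hT : T ∈ 𝒯.triangles) : interior (convexHull ℝ (T : Set Plane)) ⊆ Ω := by
  have := interior_mono (hull_subset_closure hT)
  rwa [hΩ.interior_closure] at this

theorem indicator_toFun (hΩ : IsLipschitzDomain Ω) (w : 𝒯.P1) :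
    Ω.indicator w.toFun = w.toFun := by
  rw [Set.indicator_eq_self]
  intro x hx
  by_contra hxΩ
  exact hx (piecewise_of_notMem _ fun T hT h => hxΩ (interior_hull_subset hΩ hT h))

/-- An affine function vanishing in the relative interior of a segment vanishes at its end. -/
theorem eq_zero_of_lineMap {f : Plane →ᵃ[ℝ] ℝ}
    (h : ∀ t : ℝ, 0 < t → t < 1 → f (AffineMap.lineMap a b t) = 0) : f a = 0 := by
  have h1 := h (1 / 3) (by norm_num) (by norm_num)
  have h2 := h (2 / 3) (by norm_num) (by norm_num)
  rw [affine_lineMap] at h1 h2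
  linarith

/-- A conforming function is continuous across a common side of two triangles. -/
theorem S10.apply_eq_of_common_side (hΩ : IsLipschitzDomain Ω) {w : 𝒯.P1} (hw : w ∈ 𝒯.S10)
    {S T : 𝒯.triangles} (hvS : HasVertices S.1 a b c') (hvT : HasVertices T.1 a b c) :
    w S a = w T a := by
  by_cases hne : S = T
  · rw [hne]
  have hne' : S.1 ≠ T.1 := fun h => hne (Subtype.ext h)
  obtain ⟨C, hC, hU⟩ := MemH10.exists_translate_le hΩ.isOpen.measurableSet hw
  rw [indicator_toFun hΩ] at hU
  rw [← sub_eq_zero]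
  refine eq_zero_of_lineMap (b := b) (f := w S - w T) fun t ht0 ht1 => ?_
  obtain ⟨h1, h2, h3⟩ := bary_lineMap_side T.2 hvT t
  refine sub_eq_zero.2 (Eq.symm ?_)
  refine eq_of_translate_le hC hU h3 ((isBarycentric_bary T.2).self c hvT.mem₃)
    (α := w T) (β := w S) (w T).continuous_plane.continuousAt
    (w S).continuous_plane.continuousAt ?_
  filter_upwards [eventually_of_two_triangles S.2 T.2 hvS hvT hne' (by rw [h1]; linarith)
    (by rw [h2]; exact ht0) h3] with x hx
  exact ⟨fun h => piecewise_of_mem_interior _ T (hx.2.1 h),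
    fun h => piecewise_of_mem_interior _ S (hx.2.2 h)⟩

/-- A conforming function vanishes on a side of only one triangle. -/
theorem S10.apply_eq_zero_of_side (hΩ : IsLipschitzDomain Ω) {w : 𝒯.P1} (hw : w ∈ 𝒯.S10)
    {T : 𝒯.triangles} (hvT : HasVertices T.1 a b c)
    (honly : ∀ S ∈ 𝒯.triangles, a ∈ S → b ∈ S → S = T) : w T a = 0 := by
  obtain ⟨C, hC, hU⟩ := MemH10.exists_translate_le hΩ.isOpen.measurableSet hw
  rw [indicator_toFun hΩ] at hU
  refine eq_zero_of_lineMap (b := b) (f := w T) fun t ht0 ht1 => ?_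
  obtain ⟨h1, h2, h3⟩ := bary_lineMap_side T.2 hvT t
  refine eq_of_translate_le hC hU h3 ((isBarycentric_bary T.2).self c hvT.mem₃)
    (α := w T) (β := fun _ => 0) (w T).continuous_plane.continuousAt continuousAt_const ?_
  filter_upwards [eventually_of_one_triangle T.2 hvT honly (by rw [h1]; linarith)
    (by rw [h2]; exact ht0) h3] with x hx
  exact ⟨fun h => piecewise_of_mem_interior _ T (hx.1 h),
    fun h => piecewise_of_notMem _ fun S hS hxS => hx.2 h S hS (interior_subset hxS)⟩

/-- Unless `w ∈ S¹₀` vanishes at the node `z` in some triangle, its value there is the same in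
all triangles at `z`, and these triangles surround `z`. -/
theorem S10.fan_of_ne_zero (hΩ : IsLipschitzDomain Ω) {w : 𝒯.P1} (hw : w ∈ 𝒯.S10)
    {T : 𝒯.triangles} (hz : z ∈ T.1)
    (hside : ∀ (S : 𝒯.triangles) (b : Plane), z ∈ S.1 → b ∈ S.1 → b ≠ z → w S z = w T z →
      ∃ R ∈ 𝒯.triangles, R ≠ S ∧ z ∈ R ∧ b ∈ R) :
    z ∈ Ω ∧ ∀ S : 𝒯.triangles, z ∈ S.1 → w S z = w T z := by
  classical
  set C : Finset (Finset Plane) :=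
    (𝒯.triangles.attach.filter fun S => z ∈ S.1 ∧ w S z = w T z).image Subtype.val with hC
  have hmem : ∀ S : 𝒯.triangles, S.1 ∈ C ↔ z ∈ S.1 ∧ w S z = w T z := fun S => by
    simp [hC]
  have hCsub : C ⊆ 𝒯.trianglesAt z := by
    intro S hS
    obtain ⟨S, hS', rfl⟩ := Finset.mem_image.1 hS
    rw [trianglesAt, Finset.mem_filter]
    exact ⟨S.2, ((hmem S).1 hS).1⟩
  have hne : C.Nonempty := ⟨T.1, (hmem T).2 ⟨hz, rfl⟩⟩
  have hfan : ∀ S ∈ C, ∀ b ∈ S, b ≠ z → ∃ R ∈ C, R ≠ S ∧ b ∈ R := by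
    intro S hS b hb hbz
    obtain ⟨S, hS', rfl⟩ := Finset.mem_image.1 hS
    obtain ⟨hzS, hwS⟩ := (hmem S).1 hS
    obtain ⟨R, hR, hRS, hzR, hbR⟩ := hside S b hzS hb hbz hwS
    obtain ⟨c, hvS⟩ := exists_hasVertices (𝒯.card_eq_three _ S.2) hzS hb hbz.symm
    obtain ⟨c', hvR⟩ := exists_hasVertices (𝒯.card_eq_three _ hR) hzR hbR hbz.symm
    exact ⟨R, (hmem ⟨R, hR⟩).2 ⟨hzR, (S10.apply_eq_of_common_side hΩ hw (S := ⟨R, hR⟩)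
      hvR hvS).trans hwS⟩, hRS, hbR⟩
  refine ⟨mem_of_closed_fan hΩ hCsub hne hfan, fun S hS => ((hmem S).1 ?_).2⟩
  rw [eq_trianglesAt_of_closed_fan hCsub hne hfan, trianglesAt, Finset.mem_filter]
  exact ⟨S.2, hS⟩

/-- A conforming function has the same value at an interior node in all triangles. -/
theorem S10.apply_eq_of_mem (hΩ : IsLipschitzDomain Ω) {w : 𝒯.P1} (hw : w ∈ 𝒯.S10)
    (hzΩ : z ∈ Ω) {S T : 𝒯.triangles} (hS : z ∈ S.1) (hT : z ∈ T.1) : w S z = w T z := by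
  refine (S10.fan_of_ne_zero hΩ hw hT fun R b hzR hbR hbz _ => ?_).2 S hS
  obtain ⟨c, hv⟩ := exists_hasVertices (𝒯.card_eq_three _ R.2) hzR hbR hbz.symm
  exact exists_neighbour_of_mem hΩ.isOpen R.2 hv hzΩ

/-- A conforming function vanishes at the boundary nodes. -/
theorem S10.apply_eq_zero (hΩ : IsLipschitzDomain Ω) {w : 𝒯.P1} (hw : w ∈ 𝒯.S10)
    (hzΩ : z ∉ Ω) {T : 𝒯.triangles} (hT : z ∈ T.1) : w T z = 0 := by
  by_contra hne
  refine hzΩ (S10.fan_of_ne_zero hΩ hw hT fun R b hzR hbR hbz hwR => ?_).1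
  by_contra! h
  obtain ⟨c, hv⟩ := exists_hasVertices (𝒯.card_eq_three _ R.2) hzR hbR hbz.symm
  refine hne (hwR ▸ S10.apply_eq_zero_of_side hΩ hw hv fun S hS h1 h2 => ?_)
  by_contra hSR
  exact h S hS hSR h1 h2

end RegularTriangulation

/-! ### The estimate at one node -/

/-- Twice the signed area of the triangle with vertices `a`, `b`, `c`; it is positive if these are
in counterclockwise order. -/
noncomputable def cross (a b c : Plane) : ℝ :=
  (b 0 - a 0) * (c 1 - a 1) - (b 1 - a 1) * (c 0 - a 0)

theorem cross_swap (a b c : Plane) : cross a c b = -cross a b c := by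
  simp only [cross]; ring

/-- `cross a x c` as an affine function of `x`. -/
noncomputable def crossMap (a c : Plane) : Plane →ᵃ[ℝ] ℝ :=
  ((c 1 - a 1) • (EuclideanSpace.proj (𝕜 := ℝ) 0 : Plane →L[ℝ] ℝ) -
    (c 0 - a 0) • (EuclideanSpace.proj (𝕜 := ℝ) 1 : Plane →L[ℝ] ℝ)).toLinearMap.toAffineMap -
    AffineMap.const ℝ Plane (a 0 * (c 1 - a 1) - a 1 * (c 0 - a 0))

theorem crossMap_apply (a c x : Plane) : crossMap a c x = cross a x c := by
  simp [crossMap, cross]; ring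

theorem IsBarycentric.cross_eq {T : Finset Plane} {lam : Plane → Plane →ᵃ[ℝ] ℝ} {a b c : Plane}
    (hl : IsBarycentric T lam) (h : HasVertices T a b c) (x : Plane) :
    cross a x c = lam b x * cross a b c := by
  rw [← crossMap_apply, ← crossMap_apply]
  refine hl.eq_mul h.rotate.rotate.swap ?_ ?_ x
  · rw [crossMap_apply]; simp [cross]
  · rw [crossMap_apply]; simp [cross]; ring

theorem IsBarycentric.cross_ne_zero {T : Finset Plane} {lam : Plane → Plane →ᵃ[ℝ] ℝ}
    {a b c : Plane} (hl : IsBarycentric T lam) (h : HasVertices T a b c) : cross a b c ≠ 0 := by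
  intro h0
  have hx : ∀ x, cross a x c = 0 := fun x => by rw [hl.cross_eq h x, h0, mul_zero]
  have h1 := hx (a + EuclideanSpace.single 0 1)
  have h2 := hx (a + EuclideanSpace.single 1 1)
  simp [cross, sub_eq_zero] at h1 h2
  refine h.ne₁₃ ?_
  ext i
  fin_cases i
  · exact h2
  · exact h1.symm

theorem HasVertices.swap_right {T : Finset Plane} {a b c : Plane} (h : HasVertices T a b c) :
    HasVertices T a c b := h.rotate.rotate.swap

namespace RegularTriangulation

variable {Ω : Set Plane} {𝒯 : RegularTriangulation Ω} {z : Plane}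

theorem exists_oriented {T : Finset Plane} (hT : T ∈ 𝒯.triangles) (hz : z ∈ T) :
    ∃ p : Plane × Plane, HasVertices T z p.1 p.2 ∧ 0 < cross z p.1 p.2 := by
  obtain ⟨b, c, hv⟩ := exists_hasVertices_of_mem (𝒯.card_eq_three T hT) hz
  rcases lt_or_gt_of_ne ((isBarycentric_bary hT).cross_ne_zero hv) with h | h
  · refine ⟨(c, b), hv.swap_right, ?_⟩
    rw [cross_swap]; linarith
  · exact ⟨(b, c), hv, h⟩

variable (𝒯) in
/-- The triangles at the node `z`, as a type. -/
abbrev At (z : Plane) : Type := {T : 𝒯.triangles // z ∈ T.1}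

/-- The first vertex after `z` of a triangle at `z`, in counterclockwise order. -/
noncomputable def At.right (T : 𝒯.At z) : Plane := (exists_oriented T.1.2 T.2).choose.1

/-- The second vertex after `z` of a triangle at `z`, in counterclockwise order. -/
noncomputable def At.left (T : 𝒯.At z) : Plane := (exists_oriented T.1.2 T.2).choose.2

namespace At

theorem hasVertices (T : 𝒯.At z) : HasVertices T.1.1 z T.right T.left :=
  (exists_oriented T.1.2 T.2).choose_spec.1

theorem cross_pos (T : 𝒯.At z) : 0 < cross z T.right T.left :=
  (exists_oriented T.1.2 T.2).choose_spec.2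

/-- Two triangles with the same left side lie on the same side of it, hence coincide. -/
theorem left_injective : Function.Injective (At.left : 𝒯.At z → Plane) := by
  intro S T h
  by_contra hne
  have hne' : S.1.1 ≠ T.1.1 := fun h => hne (Subtype.ext (Subtype.ext h))
  have hS := S.hasVertices
  have hS2 := S.cross_pos
  rw [h] at hS hS2
  have h1 := bary_neg_of_common_side S.1.2 T.1.2 hS.swap_right T.hasVertices.swap_right hne'
  rw [(isBarycentric_bary T.1.2).cross_eq T.hasVertices] at hS2
  nlinarith [T.cross_pos]

theorem right_injective : Function.Injective (At.right : 𝒯.At z → Plane) := by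
  intro S T h
  by_contra hne
  have hne' : S.1.1 ≠ T.1.1 := fun h => hne (Subtype.ext (Subtype.ext h))
  have hS := S.hasVertices
  have hS2 := S.cross_pos
  rw [h] at hS hS2
  have h1 := bary_neg_of_common_side S.1.2 T.1.2 hS T.hasVertices hne'
  rw [cross_swap, (isBarycentric_bary T.1.2).cross_eq T.hasVertices.swap_right,
    cross_swap z T.right] at hS2
  nlinarith [T.cross_pos]

theorem eq_right_or_eq_left (T : 𝒯.At z) {b : Plane} (hb : b ∈ T.1.1) (hbz : b ≠ z) :
    b = T.right ∨ b = T.left :=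
  ((T.hasVertices.mem_iff b).1 hb).resolve_left hbz

theorem right_ne_left (T : 𝒯.At z) : T.right ≠ T.left := T.hasVertices.ne₂₃

/-- A cycle in the graph in which each triangle at `z` is succeeded by its neighbour in
counterclockwise order surrounds `z` and contains all triangles at `z`. -/
theorem mem_of_transGen (hΩ : IsLipschitzDomain Ω) {R : 𝒯.At z → 𝒯.At z → Prop}
    (hR : ∀ S T, R S T → S.left = T.right) {T : 𝒯.At z} (hT : Relation.TransGen R T T) :
    z ∈ Ω ∧ ∀ S, Relation.TransGen R T S := by
  classical
  set C : Finset (Finset Plane) := (Finset.univ.filter fun S : 𝒯.At z =>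
    Relation.TransGen R T S ∧ Relation.TransGen R S T).image fun S => S.1.1 with hC
  have hmem : ∀ S : 𝒯.At z, S.1.1 ∈ C ↔ Relation.TransGen R T S ∧ Relation.TransGen R S T := by
    intro S
    simp only [hC, Finset.mem_image, Finset.mem_filter, Finset.mem_univ, true_and]
    constructor
    · rintro ⟨S', h, h'⟩
      rwa [Subtype.ext (Subtype.ext h')] at h
    · exact fun h => ⟨S, h, rfl⟩
  have hCsub : C ⊆ 𝒯.trianglesAt z := by
    intro S hS
    obtain ⟨S, -, rfl⟩ := Finset.mem_image.1 hS
    rw [trianglesAt, Finset.mem_filter]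
    exact ⟨S.1.2, S.2⟩
  have hne : C.Nonempty := ⟨_, (hmem T).2 ⟨hT, hT⟩⟩
  have hstep : ∀ S S' : 𝒯.At z, R S S' → S'.1.1 ≠ S.1.1 := fun S S' h h' => by
    have : S' = S := Subtype.ext (Subtype.ext h')
    subst this
    exact S'.right_ne_left (hR _ _ h).symm
  have hfan : ∀ S ∈ C, ∀ b ∈ S, b ≠ z → ∃ S' ∈ C, S' ≠ S ∧ b ∈ S' := by
    intro S hS b hb hbz
    obtain ⟨S, -, rfl⟩ := Finset.mem_image.1 hS
    obtain ⟨h1, h2⟩ := (hmem S).1 hS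
    rcases S.eq_right_or_eq_left hb hbz with rfl | rfl
    · obtain ⟨P, hP1, hP2⟩ := Relation.TransGen.tail'_iff.1 h1
      refine ⟨P.1.1, (hmem P).2 ⟨?_, .head hP2 h2⟩, (hstep _ _ hP2).symm, ?_⟩
      · rcases Relation.reflTransGen_iff_eq_or_transGen.1 hP1 with h | h
        · exact h ▸ hT
        · exact h
      · rw [← hR _ _ hP2]; exact P.hasVertices.mem₃
    · obtain ⟨P, hP1, hP2⟩ := Relation.TransGen.head'_iff.1 h2
      refine ⟨P.1.1, (hmem P).2 ⟨.tail h1 hP1, ?_⟩, hstep _ _ hP1, ?_⟩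
      · rcases Relation.reflTransGen_iff_eq_or_transGen.1 hP2 with h | h
        · exact h ▸ hT
        · exact h
      · rw [hR _ _ hP1]; exact P.hasVertices.mem₂
  refine ⟨mem_of_closed_fan hΩ hCsub hne hfan, fun S => ((hmem S).1 ?_).1⟩
  rw [eq_trianglesAt_of_closed_fan hCsub hne hfan, trianglesAt, Finset.mem_filter]
  exact ⟨S.1.2, S.2⟩

theorem exists_left_eq_right (hΩ : IsOpen Ω) (hz : z ∈ Ω) (T : 𝒯.At z) :
    ∃ S : 𝒯.At z, T.left = S.right := by
  obtain ⟨S, hS, hne, hzS, hbS⟩ := exists_neighbour_of_mem hΩ T.1.2 T.hasVertices.swap_right hz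
  set S' : 𝒯.At z := ⟨⟨S, hS⟩, hzS⟩ with hS'
  rcases S'.eq_right_or_eq_left hbS T.hasVertices.ne₁₃.symm with h | h
  · exact ⟨S', h⟩
  · exact absurd (congrArg (fun T : 𝒯.At z => T.1.1) (left_injective h)).symm hne

theorem exists_right_eq_left (hΩ : IsOpen Ω) (hz : z ∈ Ω) (T : 𝒯.At z) :
    ∃ S : 𝒯.At z, S.left = T.right := by
  obtain ⟨S, hS, hne, hzS, hbS⟩ := exists_neighbour_of_mem hΩ T.1.2 T.hasVertices hz
  set S' : 𝒯.At z := ⟨⟨S, hS⟩, hzS⟩ with hS'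
  rcases S'.eq_right_or_eq_left hbS T.hasVertices.ne₁₂.symm with h | h
  · exact absurd (congrArg (fun T : 𝒯.At z => T.1.1) (right_injective h)).symm hne
  · exact ⟨S', h.symm⟩

end At

/-- A sum of squared distances to `y` is convex in `y`, hence on a convex hull it is at most its
value at one of the points. -/
theorem exists_sum_sq_le {V : Type*} [Fintype V] (x : V → ℝ) {s : Set ℝ} {y : ℝ}
    (hy : y ∈ convexHull ℝ s) : ∃ y' ∈ s, ∑ T, (x T - y) ^ 2 ≤ ∑ T, (x T - y') ^ 2 := by
  have hconv : ConvexOn ℝ Set.univ fun y : ℝ => ∑ T, (x T - y) ^ 2 := by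
    refine ⟨convex_univ, fun y₁ _ y₂ _ a b ha hb hab => ?_⟩
    simp only [smul_eq_mul]
    rw [Finset.mul_sum, Finset.mul_sum, ← Finset.sum_add_distrib]
    refine Finset.sum_le_sum fun T _ => ?_
    obtain rfl : b = 1 - a := by linarith
    nlinarith [mul_nonneg (mul_nonneg ha hb) (sq_nonneg (y₁ - y₂))]
  exact hconv.exists_ge_of_mem_convexHull (Set.subset_univ _) hy

theorem affine_midpoint (f : Plane →ᵃ[ℝ] ℝ) (a b : Plane) :
    f (midpoint ℝ a b) = (f a + f b) / 2 := by
  rw [midpoint, affine_lineMap]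
  simp
  ring

theorem At.pair_eq (hΩ : IsLipschitzDomain Ω) {v : 𝒯.P1} (hv : v ∈ 𝒯.CR10) {S T : 𝒯.At z}
    (h : S.left = T.right) (y : ℝ) : (v S.1 z - y) - (v T.1 z - y) =
      (v S.1 z - v S.1 S.left) / 2 - (v T.1 z - v T.1 T.right) / 2 := by
  have hT := T.hasVertices
  rw [← h] at hT
  have := CR10.midpoint_eq hΩ hv S.hasVertices.swap_right hT
  rw [affine_midpoint, affine_midpoint] at this
  rw [← h]
  linarith

/-- The estimate at one node, with the constant given by the number of its triangles. -/
theorem At.sum_sq_le (hΩ : IsLipschitzDomain Ω) {v : 𝒯.P1} (hv : v ∈ 𝒯.CR10) {y : ℝ}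
    (hint : z ∈ Ω → y ∈ convexHull ℝ {t : ℝ | ∃ T : 𝒯.triangles, z ∈ T.1 ∧ t = v T z})
    (hbd : z ∉ Ω → y = 0) :
    (1 - Real.cos (Real.pi / Fintype.card (𝒯.At z))) * ∑ T : 𝒯.At z, (v T.1 z - y) ^ 2 ≤
      ∑ T : 𝒯.At z, (((v T.1 z - v T.1 T.left) / 2) ^ 2 + ((v T.1 z - v T.1 T.right) / 2) ^ 2) := by
  by_cases hz : z ∈ Ω
  · obtain ⟨y', ⟨k, hzk, rfl⟩, hle⟩ := exists_sum_sq_le (fun T : 𝒯.At z => v T.1 z) (hint hz)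
    refine (mul_le_mul_of_nonneg_left hle (sub_nonneg.2 (Real.cos_le_one _))).trans ?_
    refine discrete_friedrichs_cycle (f := fun T : 𝒯.At z => v T.1 z - v k z) (k := ⟨k, hzk⟩)
      At.left_injective At.right_injective (At.exists_left_eq_right hΩ.isOpen hz)
      (At.exists_right_eq_left hΩ.isOpen hz) (fun T hT => ?_)
      (fun S T h => At.pair_eq hΩ hv h _) (sub_self _)
    obtain ⟨P, -, hP⟩ := Relation.TransGen.tail'_iff.1
      ((At.mem_of_transGen hΩ (fun S T h => h.1) hT).2 ⟨k, hzk⟩)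
    exact hP.2 rfl
  · rw [hbd hz]
    refine discrete_friedrichs_path (f := fun T : 𝒯.At z => v T.1 z - 0)
      At.left_injective At.right_injective
      (fun T hT => hz (At.mem_of_transGen hΩ (fun S T h => h) hT).1)
      (fun S T h => At.pair_eq hΩ hv h _) (fun T hT => ?_) (fun T hT => ?_)
    · have := CR10.midpoint_eq_zero hΩ hv T.hasVertices.swap_right fun S hS hzS hbS => by
        rcases At.eq_right_or_eq_left ⟨⟨S, hS⟩, hzS⟩ hbS T.hasVertices.ne₁₃.symm with h | h
        · exact absurd h (hT _)
        · exact (congrArg (fun T : 𝒯.At z => T.1.1) (At.left_injective h)).symm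
      rw [affine_midpoint] at this
      linarith
    · have := CR10.midpoint_eq_zero hΩ hv T.hasVertices fun S hS hzS hbS => by
        rcases At.eq_right_or_eq_left ⟨⟨S, hS⟩, hzS⟩ hbS T.hasVertices.ne₁₂.symm with h | h
        · exact (congrArg (fun T : 𝒯.At z => T.1.1) (At.right_injective h)).symm
        · exact absurd h.symm (hT _)
      rw [affine_midpoint] at this
      linarith

theorem card_at (z : Plane) : Fintype.card (𝒯.At z) = (𝒯.trianglesAt z).card := by
  classical
  rw [Fintype.card_subtype, trianglesAt, ← Finset.card_map (Function.Embedding.subtype _)]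
  congr 1
  ext T
  simp [and_comm]

theorem card_at_le_Mpatch {T : Finset Plane} (hT : T ∈ 𝒯.triangles) (hz : z ∈ T) :
    Fintype.card (𝒯.At z) ≤ 𝒯.Mpatch := by
  classical
  rw [card_at]
  have hnode : z ∈ 𝒯.nodes := Finset.mem_biUnion.2 ⟨T, hT, hz⟩
  by_cases h : z ∈ Ω
  · exact (Finset.le_sup (f := fun z => (𝒯.trianglesAt z).card)
      (Finset.mem_filter.2 ⟨hnode, h⟩)).trans (le_max_left _ _)
  · refine (Finset.le_sup (f := fun z => (𝒯.trianglesAt z).card)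
      (Finset.mem_filter.2 ⟨hnode, ?_⟩)).trans (le_max_right _ _)
    exact ⟨hull_subset_closure hT (subset_convexHull ℝ _ hz), fun h' => h (interior_subset h')⟩

theorem one_sub_cos_le {m n : ℕ} (hm : 0 < m) (hmn : m ≤ n) :
    1 - Real.cos (Real.pi / n) ≤ 1 - Real.cos (Real.pi / m) := by
  have hpi := Real.pi_pos
  have hm' : (1 : ℝ) ≤ m := by exact_mod_cast hm
  have hmn' : (m : ℝ) ≤ n := by exact_mod_cast hmn
  have := Real.cos_le_cos_of_nonneg_of_le_pi (x := Real.pi / n) (y := Real.pi / m) (by positivity)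
    (div_le_self hpi.le hm') (by gcongr)
  linarith

theorem one_sub_cos_Mpatch_pos {T : Finset Plane} (hT : T ∈ 𝒯.triangles) :
    0 < 1 - Real.cos (Real.pi / 𝒯.Mpatch) := by
  obtain ⟨z, hz⟩ := Finset.card_pos.1 (by rw [𝒯.card_eq_three T hT]; norm_num : 0 < T.card)
  have h0 : 0 < Fintype.card (𝒯.At z) := Fintype.card_pos_iff.2 ⟨⟨⟨T, hT⟩, hz⟩⟩
  have h1 : (1 : ℝ) ≤ 𝒯.Mpatch := by exact_mod_cast h0.trans_le (card_at_le_Mpatch hT hz)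
  have hpi := Real.pi_pos
  have := Real.cos_lt_cos_of_nonneg_of_le_pi (x := 0) (y := Real.pi / 𝒯.Mpatch) le_rfl
    (div_le_self hpi.le h1) (by positivity)
  rw [Real.cos_zero] at this
  linarith

/-- The estimate at one node: the sum over the triangles at `z` of the squared distance of
`v|_T(z)` to `y` is bounded by the jumps from `z` to the other vertices. -/
theorem node_sum_sq_le (hΩ : IsLipschitzDomain Ω) {v : 𝒯.P1} (hv : v ∈ 𝒯.CR10) {y : ℝ}
    (hint : z ∈ Ω → y ∈ convexHull ℝ {t : ℝ | ∃ T : 𝒯.triangles, z ∈ T.1 ∧ t = v T z})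
    (hbd : z ∉ Ω → y = 0) :
    (1 - Real.cos (Real.pi / 𝒯.Mpatch)) * ∑ T : 𝒯.At z, (v T.1 z - y) ^ 2 ≤
      ∑ T : 𝒯.At z, ∑ b ∈ T.1.1, ((v T.1 z - v T.1 b) / 2) ^ 2 := by
  rcases isEmpty_or_nonempty (𝒯.At z) with h | ⟨⟨T⟩⟩
  · simp
  have h1 := one_sub_cos_le (Fintype.card_pos_iff.2 ⟨T⟩) (card_at_le_Mpatch T.1.2 T.2)
  refine (mul_le_mul_of_nonneg_right h1 (Finset.sum_nonneg fun _ _ => sq_nonneg _)).trans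
    ((At.sum_sq_le hΩ hv hint hbd).trans_eq (Finset.sum_congr rfl fun S _ => ?_))
  rw [S.hasVertices.sum_eq]
  ring

end RegularTriangulation

/-! ### Integrals over a triangle -/

/-- The open reference triangle. -/
def refTriangle : Set Plane := {y | 0 < y 0 ∧ 0 < y 1 ∧ y 0 + y 1 < 1}

theorem volume_refTriangle : volume refTriangle = ENNReal.ofReal (1 / 2) := by
  have hmp : MeasurePreserving (fun y : Plane => MeasurableEquiv.finTwoArrow (WithLp.ofLp y))
      volume volume :=
    (volume_preserving_finTwoArrow ℝ).comp (PiLp.volume_preserving_ofLp (Fin 2))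
  have hpre : refTriangle = (fun y : Plane => MeasurableEquiv.finTwoArrow (WithLp.ofLp y)) ⁻¹'
      regionBetween (fun _ : ℝ => (0 : ℝ)) (fun s => 1 - s) (Set.Ioo 0 1) := by
    ext y
    simp only [refTriangle, regionBetween, Set.mem_preimage, Set.mem_ofPred_eq,
      MeasurableEquiv.finTwoArrow, Set.mem_Ioo]
    change _ ↔ (0 < y 0 ∧ y 0 < 1) ∧ 0 < y 1 ∧ y 1 < 1 - y 0
    constructor
    · rintro ⟨h1, h2, h3⟩
      exact ⟨⟨h1, by linarith⟩, h2, by linarith⟩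
    · rintro ⟨⟨h1, -⟩, h2, h3⟩
      exact ⟨h1, h2, by linarith⟩
  have hms : MeasurableSet (regionBetween (fun _ : ℝ => (0 : ℝ)) (fun s => 1 - s) (Set.Ioo 0 1)) :=
    measurableSet_regionBetween measurable_const (by fun_prop) measurableSet_Ioo
  rw [hpre, hmp.measure_preimage hms.nullMeasurableSet, Measure.volume_eq_prod,
    volume_regionBetween_eq_integral]
  · congr 1
    have : ∫ y in Set.Ioo (0 : ℝ) 1, ((fun s => 1 - s) - (fun _ => 0) : ℝ → ℝ) y =
        ∫ y in (0 : ℝ)..1, (1 - y) := by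
      rw [intervalIntegral.integral_of_le zero_le_one, integral_Ioc_eq_integral_Ioo]
      simp
    rw [this, intervalIntegral.integral_sub (by simp) (by simp)]
    simp
    norm_num
  · exact integrableOn_const (by simp)
  · exact (Continuous.integrableOn_Icc (by fun_prop)).mono_set Set.Ioo_subset_Icc_self
  · exact measurableSet_Ioo
  · intro x hx
    simpa using hx.2.le

/-- The affine map of the reference triangle onto the triangle with vertices `a`, `b`, `c`. -/
noncomputable def refMap (a b c : Plane) (y : Plane) : Plane :=
  a + (y 0 • (b - a) + y 1 • (c - a))

/-- The derivative of `refMap a b c`. -/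
noncomputable def refMapDeriv (a b c : Plane) : Plane →L[ℝ] Plane :=
  (EuclideanSpace.proj (𝕜 := ℝ) 0 : Plane →L[ℝ] ℝ).smulRight (b - a) +
    (EuclideanSpace.proj (𝕜 := ℝ) 1 : Plane →L[ℝ] ℝ).smulRight (c - a)

theorem hasFDerivAt_refMap (a b c y : Plane) :
    HasFDerivAt (refMap a b c) (refMapDeriv a b c) y :=
  ((refMapDeriv a b c).hasFDerivAt).const_add a

theorem det_refMapDeriv (a b c : Plane) : (refMapDeriv a b c).det = cross a b c := by
  rw [ContinuousLinearMap.det,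
    ← LinearMap.det_toMatrix (EuclideanSpace.basisFun (Fin 2) ℝ).toBasis, Matrix.det_fin_two]
  simp [LinearMap.toMatrix_apply, refMapDeriv, cross]
  ring

section Triangle

variable {T : Finset Plane} {lam : Plane → Plane →ᵃ[ℝ] ℝ} {a b c : Plane}

theorem IsBarycentric.apply_refMap (hl : IsBarycentric T lam) (h : HasVertices T a b c)
    (y : Plane) : lam b (refMap a b c y) = y 0 ∧ lam c (refMap a b c y) = y 1 ∧
      lam a (refMap a b c y) = 1 - y 0 - y 1 := by
  have hne := hl.cross_ne_zero h
  have hb : lam b (refMap a b c y) = y 0 := by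
    have h1 := hl.cross_eq h (refMap a b c y)
    have h2 : cross a (refMap a b c y) c = y 0 * cross a b c := by
      simp [cross, refMap]; ring
    exact (mul_right_cancel₀ hne (h2.symm.trans h1)).symm
  have hc : lam c (refMap a b c y) = y 1 := by
    have h1 := hl.cross_eq h.swap_right (refMap a b c y)
    have h2 : cross a (refMap a b c y) b = y 1 * cross a c b := by
      simp [cross, refMap]; ring
    refine (mul_right_cancel₀ ?_ (h2.symm.trans h1)).symm
    rw [cross_swap]; exact neg_ne_zero.2 hne
  refine ⟨hb, hc, ?_⟩
  have := hl.sum_eq_one (refMap a b c y)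
  rw [h.sum_eq, hb, hc] at this
  linarith

theorem IsBarycentric.refMap_image (hl : IsBarycentric T lam) (h : HasVertices T a b c) :
    refMap a b c '' refTriangle = interior (convexHull ℝ (T : Set Plane)) := by
  ext x
  rw [hl.mem_interior, h.forall_iff]
  constructor
  · rintro ⟨y, ⟨h0, h1, h2⟩, rfl⟩
    obtain ⟨e1, e2, e3⟩ := hl.apply_refMap h y
    rw [e1, e2, e3]
    exact ⟨by linarith, h0, h1⟩
  · rintro ⟨ha, hb, hc⟩
    have hsum := hl.sum_eq_one x
    rw [h.sum_eq] at hsum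
    refine ⟨!₂[lam b x, lam c x], ⟨hb, hc, ?_⟩, ?_⟩
    · change lam b x + lam c x < 1
      linarith
    · ext i
      have := hl.expand (EuclideanSpace.proj (𝕜 := ℝ) i : Plane →L[ℝ] ℝ).toLinearMap.toAffineMap x
      rw [h.sum_eq] at this
      have ha' : lam a x = 1 - lam b x - lam c x := by linarith
      rw [ha'] at this
      simp at this
      simp [refMap]
      rw [this]
      ring

theorem measurableSet_refTriangle : MeasurableSet refTriangle := by
  have h0 : Continuous fun y : Plane => y 0 := by fun_prop
  have h1 : Continuous fun y : Plane => y 1 := by fun_prop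
  exact ((isOpen_lt continuous_const h0).inter ((isOpen_lt continuous_const h1).inter
    (isOpen_lt (h0.add h1) continuous_const))).measurableSet

theorem IsBarycentric.lintegral_eq (hl : IsBarycentric T lam) (h : HasVertices T a b c)
    (g : Plane → ℝ≥0∞) : ∫⁻ x in interior (convexHull ℝ (T : Set Plane)), g x =
      ENNReal.ofReal |cross a b c| * ∫⁻ y in refTriangle, g (refMap a b c y) := by
  rw [← hl.refMap_image h, lintegral_image_eq_lintegral_abs_det_fderiv_mul volume
    measurableSet_refTriangle (fun y _ => (hasFDerivAt_refMap a b c y).hasFDerivWithinAt)]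
  · simp_rw [det_refMapDeriv]
    rw [lintegral_const_mul' _ _ ENNReal.ofReal_ne_top]
  · intro y _ y' _ hyy
    have e := hl.apply_refMap h y
    have e' := hl.apply_refMap h y'
    rw [hyy] at e
    ext i
    fin_cases i
    · exact e.1.symm.trans e'.1
    · exact e.2.1.symm.trans e'.2.1

/-- The area of a triangle. -/
theorem IsBarycentric.volume_interior (hl : IsBarycentric T lam) (h : HasVertices T a b c) :
    volume (interior (convexHull ℝ (T : Set Plane))) = ENNReal.ofReal (|cross a b c| / 2) := by
  have := hl.lintegral_eq h fun _ => 1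
  simp only [lintegral_one, Measure.restrict_apply_univ] at this
  rw [this, volume_refTriangle, ← ENNReal.ofReal_mul (abs_nonneg _)]
  congr 1; ring

theorem abs_cross_rotate (a b c : Plane) : |cross b c a| = |cross a b c| := by
  congr 1; simp only [cross]; ring

/-- The integral of a barycentric coordinate is a third of the area: by affine equivalence with the
reference triangle the three integrals agree, and the coordinates add up to `1`. -/
theorem IsBarycentric.lintegral_coord (hl : IsBarycentric T lam) (h : HasVertices T a b c)
    {p : Plane} (hp : p ∈ T) :
    ∫⁻ x in interior (convexHull ℝ (T : Set Plane)), ENNReal.ofReal (lam p x) =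
      ENNReal.ofReal (|cross a b c| / 6) := by
  set I : Plane → ℝ≥0∞ := fun p =>
    ∫⁻ x in interior (convexHull ℝ (T : Set Plane)), ENNReal.ofReal (lam p x) with hI
  have key : ∀ {a b c}, HasVertices T a b c →
      I b = ENNReal.ofReal |cross a b c| * ∫⁻ y in refTriangle, ENNReal.ofReal (y 0) := by
    intro a b c h
    rw [hI]
    simp only [hl.lintegral_eq h, (hl.apply_refMap h _).1]
  have hb := key h
  have hc := key h.rotate
  have ha := key h.rotate.rotate
  rw [abs_cross_rotate] at hc
  rw [abs_cross_rotate, abs_cross_rotate] at ha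
  have hsum : ∑ p ∈ T, I p = ENNReal.ofReal (|cross a b c| / 2) := by
    rw [hI, ← lintegral_finsetSum _ fun p _ =>
      (lam p).continuous_plane.measurable.ennreal_ofReal, ← hl.volume_interior h]
    rw [← setLIntegral_one]
    refine setLIntegral_congr_fun isOpen_interior.measurableSet fun x hx => ?_
    beta_reduce
    rw [← ENNReal.ofReal_sum_of_nonneg fun p hp => ((hl.mem_interior x).1 hx p hp).le,
      hl.sum_eq_one, ENNReal.ofReal_one]
  rw [h.sum_eq, ha, hc, ← hb] at hsum
  have hIb : I b = ENNReal.ofReal (|cross a b c| / 6) := by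
    have h3 : I b + I b + I b = 3 * I b := by ring
    have h3' : ENNReal.ofReal (|cross a b c| / 2) = 3 * ENNReal.ofReal (|cross a b c| / 6) := by
      rw [← ENNReal.ofReal_ofNat 3, ← ENNReal.ofReal_mul (by norm_num)]
      congr 1; ring
    rw [h3, h3'] at hsum
    exact (ENNReal.mul_right_inj (by norm_num) (by norm_num)).1 hsum
  change I p = _
  rcases (h.mem_iff p).1 hp with rfl | rfl | rfl
  · rw [ha, ← hb, hIb]
  · exact hIb
  · rw [hc, ← hb, hIb]

/-- The squared `L²` norm of an affine function on a triangle is at most a third of the area times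
the sum of the squares of the nodal values. -/
theorem IsBarycentric.lintegral_sq_le (hl : IsBarycentric T lam) (h : HasVertices T a b c)
    (e : Plane →ᵃ[ℝ] ℝ) :
    ∫⁻ x in interior (convexHull ℝ (T : Set Plane)), ENNReal.ofReal (e x ^ 2) ≤
      ENNReal.ofReal (|cross a b c| / 6 * ∑ p ∈ T, e p ^ 2) := by
  calc ∫⁻ x in interior (convexHull ℝ (T : Set Plane)), ENNReal.ofReal (e x ^ 2)
      ≤ ∫⁻ x in interior (convexHull ℝ (T : Set Plane)),
          ∑ p ∈ T, ENNReal.ofReal (e p ^ 2) * ENNReal.ofReal (lam p x) := by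
        refine setLIntegral_mono' isOpen_interior.measurableSet fun x hx => ?_
        have hpos := fun p hp => ((hl.mem_interior x).1 hx p hp).le
        rw [Finset.sum_congr rfl fun p _ => (ENNReal.ofReal_mul (sq_nonneg (e p))).symm,
          ← ENNReal.ofReal_sum_of_nonneg fun p hp => mul_nonneg (sq_nonneg _) (hpos p hp)]
        refine ENNReal.ofReal_le_ofReal ?_
        rw [hl.expand e x]
        have := (even_two.convexOn_pow (𝕜 := ℝ)).map_sum_le (t := T) (w := fun p => lam p x)
          (p := fun p => e p) hpos (hl.sum_eq_one x) (fun _ _ => Set.mem_univ _)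
        simpa only [smul_eq_mul, mul_comm] using this
    _ = ∑ p ∈ T, ENNReal.ofReal (e p ^ 2) * ENNReal.ofReal (|cross a b c| / 6) := by
        rw [lintegral_finsetSum _ fun p _ =>
          ((lam p).continuous_plane.measurable.ennreal_ofReal).const_mul _]
        refine Finset.sum_congr rfl fun p hp => ?_
        rw [lintegral_const_mul' _ _ ENNReal.ofReal_ne_top, hl.lintegral_coord h hp]
    _ = _ := by
        rw [← Finset.sum_mul, ← ENNReal.ofReal_sum_of_nonneg fun p _ => sq_nonneg _,
          ← ENNReal.ofReal_mul (Finset.sum_nonneg fun p _ => sq_nonneg _), mul_comm]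

end Triangle

theorem norm_sub_sq_plane (a b : Plane) : ‖b - a‖ ^ 2 = (b 0 - a 0) ^ 2 + (b 1 - a 1) ^ 2 := by
  rw [EuclideanSpace.real_norm_sq_eq, Fin.sum_univ_two]; simp

theorem inner_sub_plane (a b c : Plane) : inner ℝ (b - a) (c - a) =
    (b 0 - a 0) * (c 0 - a 0) + (b 1 - a 1) * (c 1 - a 1) := by
  simp [PiLp.inner_apply, Fin.sum_univ_two, mul_comm]

/-- Weitzenböck's inequality. -/
theorem weitzenboeck (a b c : Plane) :
    2 * √3 * |cross a b c| ≤ ‖b - a‖ ^ 2 + ‖c - b‖ ^ 2 + ‖a - c‖ ^ 2 := by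
  refine abs_le_of_sq_le_sq' ?_ (by positivity) |>.2
  rw [mul_pow, mul_pow, Real.sq_sqrt (by norm_num), sq_abs, norm_sub_sq_plane, norm_sub_sq_plane,
    norm_sub_sq_plane]
  simp only [cross]
  -- with `u = b - a`, `w = c - a`, the difference of the two sides is a sum of squares in
  -- `|u|²`, `|w|²` and `u ⬝ w`
  obtain ⟨u, hu⟩ : ∃ u, u = b 0 - a 0 := ⟨_, rfl⟩
  obtain ⟨u', hu'⟩ : ∃ u', u' = b 1 - a 1 := ⟨_, rfl⟩
  obtain ⟨w, hw⟩ : ∃ w, w = c 0 - a 0 := ⟨_, rfl⟩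
  obtain ⟨w', hw'⟩ : ∃ w', w' = c 1 - a 1 := ⟨_, rfl⟩
  rw [show c 0 - b 0 = w - u by rw [hw, hu]; ring, show c 1 - b 1 = w' - u' by rw [hw', hu']; ring,
    show a 0 - c 0 = -w by rw [hw]; ring, show a 1 - c 1 = -w' by rw [hw']; ring, ← hu, ← hu', ← hw,
    ← hw']
  nlinarith [sq_nonneg (2 * (u * w + u' * w') - (u ^ 2 + u' ^ 2 + w ^ 2 + w' ^ 2) / 2),
    sq_nonneg (u ^ 2 + u' ^ 2 - w ^ 2 - w' ^ 2)]

theorem abs_cross_le_diam_sq {T : Finset Plane} {a b c : Plane} (h : HasVertices T a b c) :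
    |cross a b c| ≤ √3 / 2 * Metric.diam (convexHull ℝ (T : Set Plane)) ^ 2 := by
  have hbdd : Bornology.IsBounded (convexHull ℝ (T : Set Plane)) :=
    isBounded_convexHull.2 T.finite_toSet.isBounded
  have hd : ∀ {p q}, p ∈ T → q ∈ T → ‖p - q‖ ^ 2 ≤
      Metric.diam (convexHull ℝ (T : Set Plane)) ^ 2 := fun {p q} hp hq => by
    rw [← dist_eq_norm]
    gcongr
    exact Metric.dist_le_diam_of_mem hbdd (subset_convexHull ℝ _ hp) (subset_convexHull ℝ _ hq)
  have h1 := weitzenboeck a b c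
  have h2 := hd h.mem₂ h.mem₁
  have h3 := hd h.mem₃ h.mem₂
  have h4 := hd h.mem₁ h.mem₃
  have h5 : √3 * √3 = 3 := Real.mul_self_sqrt (by norm_num)
  have h6 : 0 < √3 := by positivity
  have h7 : √3 * (2 * |cross a b c|) ≤
      √3 * (√3 * Metric.diam (convexHull ℝ (T : Set Plane)) ^ 2) := by
    rw [← mul_assoc √3 √3, h5]
    linarith
  have := le_of_mul_le_mul_left h7 h6
  linarith

/-- A lower bound for the angle at `a` in terms of the cotangent. -/
theorem inner_le_cot_mul {a b c : Plane} {ω₀ : ℝ} (hω₀ : 0 < ω₀)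
    (hangle : ω₀ ≤ EuclideanGeometry.angle b a c) (hne : cross a b c ≠ 0) :
    inner ℝ (b - a) (c - a) ≤ Real.cot ω₀ * |cross a b c| := by
  set γ := EuclideanGeometry.angle b a c with hγ
  have hγ' : γ = InnerProductGeometry.angle (b - a) (c - a) := rfl
  have hcos : Real.cos γ * (‖b - a‖ * ‖c - a‖) = inner ℝ (b - a) (c - a) :=
    InnerProductGeometry.cos_angle_mul_norm_mul_norm _ _
  have hsin : Real.sin γ * (‖b - a‖ * ‖c - a‖) = |cross a b c| := by
    rw [hγ', InnerProductGeometry.sin_angle_mul_norm_mul_norm, ← Real.sqrt_sq_eq_abs]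
    congr 1
    rw [real_inner_self_eq_norm_sq, real_inner_self_eq_norm_sq, norm_sub_sq_plane,
      norm_sub_sq_plane, inner_sub_plane]
    simp only [cross]
    ring
  have hγpi : γ ≤ Real.pi := EuclideanGeometry.angle_le_pi _ _ _
  have hγlt : γ < Real.pi := lt_of_le_of_ne hγpi fun h => by
    rw [h, Real.sin_pi, zero_mul] at hsin
    exact hne (abs_eq_zero.1 hsin.symm)
  have hs0 : 0 < Real.sin ω₀ := Real.sin_pos_of_pos_of_lt_pi hω₀ (by linarith)
  have hsub : 0 ≤ Real.sin (γ - ω₀) :=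
    Real.sin_nonneg_of_nonneg_of_le_pi (by linarith) (by linarith)
  rw [Real.sin_sub] at hsub
  have hle : Real.cos γ ≤ Real.cot ω₀ * Real.sin γ := by
    rw [Real.cot_eq_cos_div_sin, div_mul_eq_mul_div, le_div_iff₀ hs0]
    linarith
  calc inner ℝ (b - a) (c - a) = Real.cos γ * (‖b - a‖ * ‖c - a‖) := hcos.symm
    _ ≤ Real.cot ω₀ * Real.sin γ * (‖b - a‖ * ‖c - a‖) := by gcongr
    _ = Real.cot ω₀ * |cross a b c| := by rw [mul_assoc, hsin]

theorem hasFDerivAt_affine (f : Plane →ᵃ[ℝ] ℝ) (x : Plane) :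
    HasFDerivAt f (LinearMap.toContinuousLinearMap f.linear) x := by
  have h := (LinearMap.toContinuousLinearMap f.linear).hasFDerivAt (x := x) |>.add_const (f 0)
  have e : (f : Plane → ℝ) = fun x => LinearMap.toContinuousLinearMap f.linear x + f 0 := by
    funext y; exact congrFun f.decomp y
  rw [e]
  simpa using h

theorem affine_sub_sq_le (f : Plane →ᵃ[ℝ] ℝ) (p q : Plane) :
    (f p - f q) ^ 2 ≤ ‖gradient f 0‖ ^ 2 * ‖p - q‖ ^ 2 := by
  have h1 : f p - f q = inner ℝ (gradient f 0) (p - q) := by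
    rw [gradient, (hasFDerivAt_affine f 0).fderiv, InnerProductSpace.toDual_symm_apply]
    exact (f.linearMap_vsub p q).symm
  rw [h1, ← mul_pow, ← sq_abs]
  gcongr
  exact abs_real_inner_le_norm _ _

theorem gradient_affine_eq (f : Plane →ᵃ[ℝ] ℝ) (x : Plane) : gradient f x = gradient f 0 := by
  rw [gradient, gradient, (hasFDerivAt_affine f x).fderiv, (hasFDerivAt_affine f 0).fderiv]

/-! ### The global and the local estimate -/

namespace RegularTriangulation

variable {Ω : Set Plane} {𝒯 : RegularTriangulation Ω} {ω₀ : ℝ}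

/-- The sum of the squared side lengths of a triangle is four times its area times the sum of the
cotangents of its angles, each of which is at most `cot ω₀`. -/
theorem sum_sq_sides_le (hω₀ : 0 < ω₀) (hangle : 𝒯.MinAngleAtLeast ω₀) {T : Finset Plane}
    (hT : T ∈ 𝒯.triangles) {a b c : Plane} (h : HasVertices T a b c) :
    ‖b - a‖ ^ 2 + ‖c - b‖ ^ 2 + ‖a - c‖ ^ 2 ≤ 6 * Real.cot ω₀ * |cross a b c| := by
  have hne := (isBarycentric_bary hT).cross_ne_zero h
  have key : ∀ {a b c}, HasVertices T a b c →
      inner ℝ (b - a) (c - a) ≤ Real.cot ω₀ * |cross a b c| := fun {a b c} h =>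
    inner_le_cot_mul hω₀ (hangle T hT b h.mem₂ a h.mem₁ c h.mem₃ h.ne₁₂.symm h.ne₁₃ h.ne₂₃)
      ((isBarycentric_bary hT).cross_ne_zero h)
  have h1 := key h
  have h2 := key h.rotate
  have h3 := key h.rotate.rotate
  rw [abs_cross_rotate] at h2
  rw [abs_cross_rotate, abs_cross_rotate] at h3
  rw [inner_sub_plane] at h1 h2 h3
  rw [norm_sub_sq_plane, norm_sub_sq_plane, norm_sub_sq_plane]
  linarith

theorem cot_pos (hω₀ : 0 < ω₀) (hangle : 𝒯.MinAngleAtLeast ω₀) {T : Finset Plane}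
    (hT : T ∈ 𝒯.triangles) : 0 < Real.cot ω₀ := by
  obtain ⟨a, ha⟩ := Finset.card_pos.1 (by rw [𝒯.card_eq_three T hT]; norm_num : 0 < T.card)
  obtain ⟨b, c, h⟩ := exists_hasVertices_of_mem (𝒯.card_eq_three T hT) ha
  have h1 := sum_sq_sides_le hω₀ hangle hT h
  have h2 : 0 < ‖b - a‖ := norm_pos_iff.2 (sub_ne_zero.2 h.ne₁₂.symm)
  have h3 : 0 < |cross a b c| := abs_pos.2 ((isBarycentric_bary hT).cross_ne_zero h)
  have h4 : 0 < 6 * Real.cot ω₀ * |cross a b c| := lt_of_lt_of_le (by positivity) h1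
  have h5 := (mul_pos_iff_of_pos_right h3).1 h4
  linarith

/-- The differences of the nodal values of an affine function are controlled by its gradient. -/
theorem sum_diff_sq_le (hω₀ : 0 < ω₀) (hangle : 𝒯.MinAngleAtLeast ω₀) {T : Finset Plane}
    (hT : T ∈ 𝒯.triangles) (f : Plane →ᵃ[ℝ] ℝ) :
    ENNReal.ofReal (∑ z ∈ T, ∑ b ∈ T, ((f z - f b) / 2) ^ 2) ≤
      ENNReal.ofReal (6 * Real.cot ω₀) *
        ∫⁻ x in interior (convexHull ℝ (T : Set Plane)), ‖gradient f x‖ₑ ^ 2 := by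
  obtain ⟨a, ha⟩ := Finset.card_pos.1 (by rw [𝒯.card_eq_three T hT]; norm_num : 0 < T.card)
  obtain ⟨b, c, h⟩ := exists_hasVertices_of_mem (𝒯.card_eq_three T hT) ha
  have hl := isBarycentric_bary hT
  have hcot := cot_pos hω₀ hangle hT
  have hint : ∫⁻ x in interior (convexHull ℝ (T : Set Plane)), ‖gradient f x‖ₑ ^ 2 =
      ENNReal.ofReal (‖gradient f 0‖ ^ 2 * (|cross a b c| / 2)) := by
    simp_rw [gradient_affine_eq f]
    rw [setLIntegral_const, hl.volume_interior h, ENNReal.ofReal_mul (by positivity),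
      ENNReal.ofReal_pow (norm_nonneg _), ofReal_norm]
  rw [hint, ← ENNReal.ofReal_mul (by positivity)]
  refine ENNReal.ofReal_le_ofReal ?_
  have h1 := affine_sub_sq_le f b a
  have h2 := affine_sub_sq_le f c b
  have h3 := affine_sub_sq_le f a c
  have h4 := mul_le_mul_of_nonneg_left (sum_sq_sides_le hω₀ hangle hT h)
    (sq_nonneg ‖gradient f 0‖)
  rw [h.sum_eq, h.sum_eq, h.sum_eq, h.sum_eq]
  nlinarith

/-- The weighted squared `L²` norm of an affine function on a triangle is bounded by the squares of
its nodal values. -/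
theorem lintegral_diam_inv_mul_sq_le {T : Finset Plane} (hT : T ∈ 𝒯.triangles)
    (e : Plane →ᵃ[ℝ] ℝ) :
    ∫⁻ x in interior (convexHull ℝ (T : Set Plane)),
        ‖(Metric.diam (convexHull ℝ (T : Set Plane)))⁻¹ * e x‖ₑ ^ 2 ≤
      ENNReal.ofReal (√3 / 12) * ENNReal.ofReal (∑ p ∈ T, e p ^ 2) := by
  obtain ⟨a, ha⟩ := Finset.card_pos.1 (by rw [𝒯.card_eq_three T hT]; norm_num : 0 < T.card)
  obtain ⟨b, c, h⟩ := exists_hasVertices_of_mem (𝒯.card_eq_three T hT) ha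
  have hl := isBarycentric_bary hT
  set d := Metric.diam (convexHull ℝ (T : Set Plane)) with hd
  have hcr := abs_cross_le_diam_sq h
  rw [← hd] at hcr
  have hd0 : d ≠ 0 := fun h0 => hl.cross_ne_zero h <| by
    rw [h0] at hcr
    exact abs_nonpos_iff.1 (by simpa using hcr)
  have hd2 : 0 < d ^ 2 := by positivity
  have hpt : ∀ x, ‖d⁻¹ * e x‖ₑ ^ 2 = ENNReal.ofReal (d⁻¹ ^ 2) * ENNReal.ofReal (e x ^ 2) := by
    intro x
    rw [← ENNReal.ofReal_mul (by positivity), ← mul_pow, Real.enorm_eq_ofReal_abs,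
      ← ENNReal.ofReal_pow (abs_nonneg _), sq_abs]
  simp_rw [hpt]
  rw [lintegral_const_mul' _ _ ENNReal.ofReal_ne_top]
  refine (mul_le_mul_right (hl.lintegral_sq_le h e) _).trans ?_
  rw [← ENNReal.ofReal_mul (by positivity), ← ENNReal.ofReal_mul (by positivity), ← mul_assoc]
  refine ENNReal.ofReal_le_ofReal (mul_le_mul_of_nonneg_right ?_
    (Finset.sum_nonneg fun p _ => sq_nonneg _))
  rw [inv_pow, inv_mul_le_iff₀ hd2]
  linarith

/-- The contribution of the node `z` and the triangles at `z` to the error. -/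
theorem sum_error_at_le (hΩ : IsLipschitzDomain Ω) {v w : 𝒯.P1} (hv : v ∈ 𝒯.CR10)
    (hw : w ∈ 𝒯.S10) (hconv : ∀ z ∈ 𝒯.interiorNodes, ∀ K : 𝒯.triangles, z ∈ K.1 →
      w K z ∈ convexHull ℝ {t : ℝ | ∃ T : 𝒯.triangles, z ∈ T.1 ∧ t = v T z}) (z : Plane) :
    (1 - Real.cos (Real.pi / 𝒯.Mpatch)) * ∑ T : 𝒯.At z, (v T.1 z - w T.1 z) ^ 2 ≤
      ∑ T : 𝒯.At z, ∑ b ∈ T.1.1, ((v T.1 z - v T.1 b) / 2) ^ 2 := by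
  classical
  rcases isEmpty_or_nonempty (𝒯.At z) with h | ⟨⟨K⟩⟩
  · simp
  have hy : ∀ T : 𝒯.At z, w T.1 z = w K.1 z := fun T => by
    by_cases hz : z ∈ Ω
    · exact S10.apply_eq_of_mem hΩ hw hz T.2 K.2
    · rw [S10.apply_eq_zero hΩ hw hz T.2, S10.apply_eq_zero hΩ hw hz K.2]
  simp_rw [hy]
  refine node_sum_sq_le hΩ hv (fun hz => hconv z ?_ K.1 K.2)
    fun hz => S10.apply_eq_zero hΩ hw hz K.2
  exact Finset.mem_filter.2 ⟨Finset.mem_biUnion.2 ⟨K.1.1, K.1.2, K.2⟩, hz⟩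

open Classical in
theorem sum_sum_at (f : 𝒯.triangles → Plane → ℝ) :
    ∑ z ∈ 𝒯.nodes, ∑ T : 𝒯.At z, f T.1 z = ∑ T : 𝒯.triangles, ∑ z ∈ T.1, f T z := by
  have h1 : ∀ z, ∑ T : 𝒯.At z, f T.1 z = ∑ T : 𝒯.triangles with z ∈ T.1, f T z := fun z =>
    (Finset.sum_subtype _ (by simp) fun T => f T z).symm
  simp_rw [h1]
  refine Finset.sum_comm' fun z T => ?_
  simp only [Finset.mem_filter, Finset.mem_univ, true_and, and_true]
  exact ⟨fun h => h.2, fun h => ⟨Finset.mem_biUnion.2 ⟨T.1, T.2, h⟩, h⟩⟩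

theorem sum_lintegral_gradNC_le (v : 𝒯.P1) (𝒞 : Finset 𝒯.triangles) {A : Set Plane}
    (hA : ∀ T ∈ 𝒞, interior (convexHull ℝ (T.1 : Set Plane)) ⊆ A) :
    ∑ T ∈ 𝒞, ∫⁻ x in interior (convexHull ℝ (T.1 : Set Plane)), ‖gradient (v T) x‖ₑ ^ 2 ≤
      L2norm v.gradNC A ^ 2 := by
  rw [L2norm, eLpNorm_two_sq]
  calc ∑ T ∈ 𝒞, ∫⁻ x in interior (convexHull ℝ (T.1 : Set Plane)), ‖gradient (v T) x‖ₑ ^ 2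
      = ∑ T ∈ 𝒞, ∫⁻ x in interior (convexHull ℝ (T.1 : Set Plane)), ‖v.gradNC x‖ₑ ^ 2 := by
        refine Finset.sum_congr rfl fun T _ =>
          setLIntegral_congr_fun isOpen_interior.measurableSet fun x hx => ?_
        beta_reduce
        rw [P1.gradNC, piecewise_of_mem_interior _ T hx]
    _ = ∫⁻ x in ⋃ T ∈ 𝒞, interior (convexHull ℝ (T.1 : Set Plane)), ‖v.gradNC x‖ₑ ^ 2 := by
        refine (lintegral_biUnion_finset ?_ (fun T _ => isOpen_interior.measurableSet) _).symm
        exact fun S _ T _ h => disjoint_interior S.2 T.2 fun h' => h (Subtype.ext h')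
    _ ≤ _ := lintegral_mono_set (Set.iUnion₂_subset hA)

theorem lintegral_hull_eq {T : Finset Plane} (g : Plane → ℝ≥0∞) :
    ∫⁻ x in convexHull ℝ (T : Set Plane), g x =
      ∫⁻ x in interior (convexHull ℝ (T : Set Plane)), g x :=
  setLIntegral_congr (interior_ae_eq_of_null_frontier
    ((convex_convexHull ℝ _).addHaar_frontier volume)).symm

theorem lintegral_hull_le {v w : 𝒯.P1} (T : 𝒯.triangles) {ρ : Plane → ℝ}
    (hρ : ∀ x ∈ interior (convexHull ℝ (T.1 : Set Plane)),
      ρ x = Metric.diam (convexHull ℝ (T.1 : Set Plane))) :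
    ∫⁻ x in convexHull ℝ (T.1 : Set Plane), ‖(ρ x)⁻¹ * (v.toFun x - w.toFun x)‖ₑ ^ 2 ≤
      ENNReal.ofReal (√3 / 12) * ENNReal.ofReal (∑ p ∈ T.1, (v T p - w T p) ^ 2) := by
  rw [lintegral_hull_eq]
  refine le_trans (le_of_eq ?_) (lintegral_diam_inv_mul_sq_le T.2 (v T - w T))
  refine setLIntegral_congr_fun isOpen_interior.measurableSet fun x hx => ?_
  beta_reduce
  rw [hρ x hx, P1.toFun, P1.toFun, piecewise_of_mem_interior _ T hx,
    piecewise_of_mem_interior _ T hx]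
  rfl

/-- The constants of the estimates for the mass matrix, for the nodes and for the gradients multiply
to `c_apx²`. -/
theorem le_capx_sq_mul (hω₀ : 0 < ω₀) (hangle : 𝒯.MinAngleAtLeast ω₀) {X Y : ℝ≥0∞} {E D : ℝ}
    {T : Finset Plane} (hT : T ∈ 𝒯.triangles)
    (hX : X ^ 2 ≤ ENNReal.ofReal (√3 / 12) * ENNReal.ofReal E)
    (hE : (1 - Real.cos (Real.pi / 𝒯.Mpatch)) * E ≤ D)
    (hD : ENNReal.ofReal D ≤ ENNReal.ofReal (6 * Real.cot ω₀) * Y ^ 2) :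
    X ≤ ENNReal.ofReal (𝒯.capx ω₀) * Y := by
  have hcos := one_sub_cos_Mpatch_pos hT
  have hcot := cot_pos hω₀ hangle hT
  set κ := 1 - Real.cos (Real.pi / 𝒯.Mpatch) with hκ
  have hE' : E ≤ κ⁻¹ * D := by
    rw [← div_eq_inv_mul, le_div_iff₀ hcos, mul_comm]; exact hE
  rw [← ENNReal.pow_le_pow_left_iff two_ne_zero, mul_pow, capx,
    ← ENNReal.ofReal_pow (Real.sqrt_nonneg _), Real.sq_sqrt (by rw [← hκ]; positivity), ← hκ]
  calc X ^ 2 ≤ ENNReal.ofReal (√3 / 12) * ENNReal.ofReal E := hX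
    _ ≤ ENNReal.ofReal (√3 / 12) * ENNReal.ofReal (κ⁻¹ * D) := by gcongr
    _ = ENNReal.ofReal (√3 / 12 * κ⁻¹) * ENNReal.ofReal D := by
        rw [ENNReal.ofReal_mul (by positivity), ← mul_assoc, ← ENNReal.ofReal_mul (by positivity)]
    _ ≤ ENNReal.ofReal (√3 / 12 * κ⁻¹) * (ENNReal.ofReal (6 * Real.cot ω₀) * Y ^ 2) := by gcongr
    _ = _ := by
        rw [← mul_assoc, ← ENNReal.ofReal_mul (by positivity)]
        congr 2
        rw [div_eq_mul_inv _ κ]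
        ring

theorem ofReal_sum_diff_le (hω₀ : 0 < ω₀) (hangle : 𝒯.MinAngleAtLeast ω₀) (v : 𝒯.P1)
    (𝒞 : Finset 𝒯.triangles) {A : Set Plane}
    (hA : ∀ T ∈ 𝒞, interior (convexHull ℝ (T.1 : Set Plane)) ⊆ A) :
    ENNReal.ofReal (∑ T ∈ 𝒞, ∑ z ∈ T.1, ∑ b ∈ T.1, ((v T z - v T b) / 2) ^ 2) ≤
      ENNReal.ofReal (6 * Real.cot ω₀) * L2norm v.gradNC A ^ 2 := by
  rw [ENNReal.ofReal_sum_of_nonneg fun T _ => Finset.sum_nonneg fun z _ =>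
    Finset.sum_nonneg fun b _ => sq_nonneg _]
  calc ∑ T ∈ 𝒞, ENNReal.ofReal (∑ z ∈ T.1, ∑ b ∈ T.1, ((v T z - v T b) / 2) ^ 2)
      ≤ ∑ T ∈ 𝒞, ENNReal.ofReal (6 * Real.cot ω₀) *
          ∫⁻ x in interior (convexHull ℝ (T.1 : Set Plane)), ‖gradient (v T) x‖ₑ ^ 2 :=
        Finset.sum_le_sum fun T _ => sum_diff_sq_le hω₀ hangle T.2 (v T)
    _ ≤ _ := by
        rw [← Finset.mul_sum]
        gcongr
        exact sum_lintegral_gradNC_le v 𝒞 hA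

end RegularTriangulation

theorem theorem4p3 {Ω : Set Plane} (hΩ : IsLipschitzDomain Ω) (𝒯 : RegularTriangulation Ω)
    (ω₀ : ℝ) (hω₀ : 0 < ω₀) (hangle : 𝒯.MinAngleAtLeast ω₀)
    (J : 𝒯.CR10 → 𝒯.S10) (hJ : 𝒯.ConvexNodalValues J) (v : 𝒯.CR10) :
    L2norm (fun x => (𝒯.meshSize x)⁻¹ * (v.1.toFun x - (J v).1.toFun x)) Ω
        ≤ ENNReal.ofReal (𝒯.capx ω₀) * L2norm v.1.gradNC Ω ∧
    ∀ T ∈ 𝒯.triangles,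
      L2norm (fun x => (Metric.diam (convexHull ℝ (T : Set Plane)))⁻¹ *
          (v.1.toFun x - (J v).1.toFun x)) (convexHull ℝ (T : Set Plane))
        ≤ ENNReal.ofReal (𝒯.capx ω₀) * L2norm v.1.gradNC (𝒯.trianglePatch T) := by
  classical
  have hnode := RegularTriangulation.sum_error_at_le hΩ v.2 (J v).2 (hJ v)
  constructor
  · have hcl : (closure Ω).Nonempty := hΩ.isConnected.nonempty.closure
    rw [← 𝒯.cover] at hcl
    obtain ⟨x, hx⟩ := hcl
    obtain ⟨T₀, hT₀, -⟩ := Set.mem_iUnion₂.1 hx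
    refine RegularTriangulation.le_capx_sq_mul hω₀ hangle hT₀
      (E := ∑ T : 𝒯.triangles, ∑ p ∈ T.1, (v.1 T p - (J v).1 T p) ^ 2) ?_ ?_
      (RegularTriangulation.ofReal_sum_diff_le hω₀ hangle v.1 Finset.univ
        fun T _ => RegularTriangulation.interior_hull_subset hΩ T.2)
    · rw [L2norm, eLpNorm_two_sq,
        ENNReal.ofReal_sum_of_nonneg fun T _ => Finset.sum_nonneg fun z _ => sq_nonneg _,
        Finset.mul_sum]
      have hcov : Ω ⊆ ⋃ T : 𝒯.triangles, convexHull ℝ (T.1 : Set Plane) := by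
        refine subset_closure.trans ?_
        rw [← 𝒯.cover]
        exact Set.iUnion₂_subset fun T hT => Set.subset_iUnion
          (fun T : 𝒯.triangles => convexHull ℝ (T.1 : Set Plane)) ⟨T, hT⟩
      refine (lintegral_mono_set hcov).trans ((lintegral_iUnion_le _ _).trans ?_)
      rw [tsum_fintype]
      exact Finset.sum_le_sum fun T _ =>
        RegularTriangulation.lintegral_hull_le T fun x hx =>
          RegularTriangulation.piecewise_of_mem_interior _ T hx
    · rw [← RegularTriangulation.sum_sum_at fun T p => (v.1 T p - (J v).1 T p) ^ 2,
        ← RegularTriangulation.sum_sum_at fun T z => ∑ b ∈ T.1, ((v.1 T z - v.1 T b) / 2) ^ 2,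
        Finset.mul_sum]
      exact Finset.sum_le_sum fun z _ => hnode z
  · intro T hT
    set 𝒞 : Finset 𝒯.triangles := Finset.univ.filter fun S => ∃ z ∈ T, z ∈ S.1 with h𝒞
    refine RegularTriangulation.le_capx_sq_mul hω₀ hangle hT
      (E := ∑ p ∈ T, (v.1 ⟨T, hT⟩ p - (J v).1 ⟨T, hT⟩ p) ^ 2) ?_ ?_
      (RegularTriangulation.ofReal_sum_diff_le hω₀ hangle v.1 𝒞 fun S hS => ?_)
    · rw [L2norm, eLpNorm_two_sq]
      exact RegularTriangulation.lintegral_hull_le ⟨T, hT⟩ fun x _ => rfl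
    · have h1 : ∀ z ∈ T, (v.1 ⟨T, hT⟩ z - (J v).1 ⟨T, hT⟩ z) ^ 2 ≤
          ∑ S : 𝒯.At z, (v.1 S.1 z - (J v).1 S.1 z) ^ 2 := fun z hz =>
        Finset.single_le_sum (f := fun S : 𝒯.At z => (v.1 S.1 z - (J v).1 S.1 z) ^ 2)
          (fun S _ => sq_nonneg _) (Finset.mem_univ (⟨⟨T, hT⟩, hz⟩ : 𝒯.At z))
      rw [Finset.mul_sum]
      calc ∑ z ∈ T, (1 - Real.cos (Real.pi / 𝒯.Mpatch)) *
            (v.1 ⟨T, hT⟩ z - (J v).1 ⟨T, hT⟩ z) ^ 2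
          ≤ ∑ z ∈ T, ∑ S : 𝒯.At z, ∑ b ∈ S.1.1, ((v.1 S.1 z - v.1 S.1 b) / 2) ^ 2 :=
            Finset.sum_le_sum fun z hz => (mul_le_mul_of_nonneg_left (h1 z hz)
              (RegularTriangulation.one_sub_cos_Mpatch_pos hT).le).trans (hnode z)
        _ = ∑ z ∈ T, ∑ S : 𝒯.triangles with z ∈ S.1,
              ∑ b ∈ S.1, ((v.1 S z - v.1 S b) / 2) ^ 2 :=
            Finset.sum_congr rfl fun z _ => (Finset.sum_subtype _ (by simp)
              fun S : 𝒯.triangles => ∑ b ∈ S.1, ((v.1 S z - v.1 S b) / 2) ^ 2).symm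
        _ = ∑ S ∈ 𝒞, ∑ z ∈ T with z ∈ S.1, ∑ b ∈ S.1, ((v.1 S z - v.1 S b) / 2) ^ 2 :=
            Finset.sum_comm' fun z S => by
              simp only [h𝒞, Finset.mem_filter, Finset.mem_univ, true_and]
              exact ⟨fun h => ⟨h, z, h⟩, fun h => h.1⟩
        _ ≤ _ := by
            refine Finset.sum_le_sum fun S _ => Finset.sum_le_sum_of_subset_of_nonneg
              (fun z hz => (Finset.mem_filter.1 hz).2) fun z _ _ =>
                Finset.sum_nonneg fun b _ => sq_nonneg _
    · obtain ⟨z, hzT, hzS⟩ := (Finset.mem_filter.1 hS).2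
      refine interior_subset.trans fun x hx => ?_
      refine Set.mem_iUnion₂.2 ⟨z, hzT, Set.mem_iUnion₂.2 ⟨S.1, ?_, hx⟩⟩
      exact Finset.mem_filter.2 ⟨S.2, hzS⟩
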